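/- Let $(A,\mathfrak m)$ be a Cohen–Macaulay local ring with $d=\dim A\ge 2$ that has a canonical module, and let $I$ be a canonical ideal of $A$, i.e. an ideal $I\ne A$ with $I\cong \mathrm K_A$ as an $A$-module. For ideals $Q\subseteq J$, $Q$ is a reduction of $J$ if $J^{r+1}=QJ^r$ for some $r\ge 0$. A parameter ideal $Q=(a_1,\dots,a_d)$ of $A$ satisfies condition $(\sharp)$ with respect to $I$ if $a_1\in I$ and $Q$ is a reduction of $I+Q$. For such $Q$ put $J=I+Q$, $\mathcal R(J)=A[Jt]$, $\mathcal T=\mathcal R(Q)=A[Qt]$, and let $\mathcal S_Q(J)=J\mathcal R(J)/J\mathcal T\cong\bigoplus_{i\ge1}J^{i+1}/JQ^i$ be the Sally module, a graded $\mathcal T$-module, with $\operatorname{rank}\mathcal S_Q(J)=\ell_{\mathcal T_{\mathfrak p}}(\mathcal S_Q(J)_{\mathfrak p})$, where $\mathfrak p=\mathfrak m\mathcal T\in\operatorname{Spec}\mathcal T$. For an integer $n\ge0$, $A$ is $n$-Goto with respect to $Q$ if $\mathcal S_Q(J)$ is generated over $\mathcal T$ by its homogeneous elements of degree one and $\operatorname{rank}\mathcal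 S_Q(J)=n$. These notions are used in the same way for other Cohen–Macaulay local rings of positive dimension with a given canonical ideal. An element $x\in J$ is super-regular with respect to $J$ if $xt\in\mathcal R(J)$ is regular on $\operatorname{gr}_J(A)=\mathcal R(J)/J\mathcal R(J)$. **Theorem 3.5.** Let $n\ge 0$ be an integer, let $Q=(a_1,\dots,a_d)$ be a parameter ideal of $A$ satisfying $(\sharp)$ with respect to $I$, and put $\mathfrak q=(a_2,\dots,a_d)$ and $J=I+Q$. Let $x\in\mathfrak q\setminus\mathfrak m\mathfrak q$ be super-regular with respect to $J$. Then $A/(x)$ is a Cohen–Macaulay local ring, $(I+(x))/(x)$ is a canonical ideal of it, $Q/(x)$ is a parameter ideal of $A/(x)$ satisfying $(\sharp)$ with respect to $(I+(x))/(x)$, and the following are equivalent: 1. $A$ is an $n$-Goto ring with respect to $Q$ (and $I$); 2. $A/(x)$ is an $n$-Goto ring with respect to $Q/(x)$ (and $(I+(x))/(x)$). -/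

import Mathlib

open CategoryTheory Polynomial

universe u

namespace GotoRing

noncomputable section

/-- A Cohen-Macaulay local ring: a Noetherian local ring `A` having an `A`-regular sequence of
length `dim A`. (The condition `(rs) A ≠ A` contained in `IsRegular` forces the members of the
sequence into the maximal ideal.) -/
class IsCohenMacaulayLocalRing (A : Type u) [CommRing A] : Prop extends
    IsLocalRing A, IsNoetherianRing A where
  exists_isRegular : ∃ rs : List A,
    RingTheory.Sequence.IsRegular A rs ∧ ringKrullDim A = (rs.length : WithBot ℕ∞)

/-- A canonical module of a (Cohen-Macaulay) local ring `A` with residue field `k`: a maximal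
Cohen-Macaulay module (finitely generated, with a regular sequence of length `d = dim A`) of finite
injective dimension and of type one, i.e. `ℓ_A (Ext^d_A (k, K)) = 1`. -/
structure IsCanonicalModule (A : Type u) [CommRing A] [IsLocalRing A]
    (K : Type u) [AddCommGroup K] [Module A K] : Prop where
  finite : Module.Finite A K
  exists_isRegular : ∃ rs : List A,
    RingTheory.Sequence.IsRegular K rs ∧ ringKrullDim A = (rs.length : WithBot ℕ∞)
  finite_injectiveDimension : ∃ r : ℕ, HasInjectiveDimensionLE (ModuleCat.of A K) r
  type_eq_one : ∀ d : ℕ, ringKrullDim A = (d : WithBot ℕ∞) →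
    Module.length A (Abelian.Ext (ModuleCat.of A (IsLocalRing.ResidueField A))
      (ModuleCat.of A K) d) = 1

variable {A : Type u} [CommRing A]

/-- A canonical ideal: a proper ideal that is a canonical module. -/
structure IsCanonicalIdeal [IsLocalRing A] (I : Ideal A) : Prop where
  ne_top : I ≠ ⊤
  isCanonicalModule : IsCanonicalModule A I

/-- `Q` is a reduction of `J`. -/
def IsReduction (Q J : Ideal A) : Prop :=
  Q ≤ J ∧ ∃ r : ℕ, J ^ (r + 1) = Q * J ^ r

/-- `a` is a system of parameters of the local ring `A` (so that `(a)` is a parameter ideal):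
it has `dim A` members and generates an ideal primary to the maximal ideal. -/
structure IsSystemOfParameters [IsLocalRing A] {d : ℕ} (a : Fin d → A) : Prop where
  dim_eq : ringKrullDim A = (d : WithBot ℕ∞)
  radical_eq : (Ideal.span (Set.range a)).radical = IsLocalRing.maximalIdeal A

/-- The condition `(♯)` for `Q = (a_1, …, a_d)` relative to the ideal `I`: `a` is a system of
parameters, its first member lies in `I`, and `Q` is a reduction of `I + Q`. -/
structure IsSharpSystem [IsLocalRing A] (I : Ideal A) {d : ℕ} [NeZero d] (a : Fin d → A) :
    Prop where
  isSystemOfParameters : IsSystemOfParameters a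
  first_mem : a 0 ∈ I
  isReduction : IsReduction (Ideal.span (Set.range a)) (I ⊔ Ideal.span (Set.range a))

/-- The parameter ideal `Q` satisfies the condition `(♯)`: it can be written `Q = (a_1, …, a_d)`
with a system of parameters `a` that satisfies it. -/
def SatisfiesSharp [IsLocalRing A] (I Q : Ideal A) : Prop :=
  ∃ (d : ℕ) (_ : NeZero d) (a : Fin d → A), IsSharpSystem I a ∧ Ideal.span (Set.range a) = Q

/-- The Rees algebra `R(J) = A[Jt] ⊆ A[t]`, as a type of its own. -/
def Rees (J : Ideal A) : Type u := reesAlgebra J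

instance (J : Ideal A) : CommRing (Rees J) := inferInstanceAs (CommRing (reesAlgebra J))

instance (J : Ideal A) : Algebra A (Rees J) := inferInstanceAs (Algebra A (reesAlgebra J))

instance (J : Ideal A) : Algebra (Rees J) A[X] := inferInstanceAs (Algebra (reesAlgebra J) A[X])

/-- The associated graded ring `gr_J(A) = R(J) / J R(J)`. -/
abbrev AssociatedGraded (J : Ideal A) : Type u :=
  Rees J ⧸ J.map (algebraMap A (Rees J))

/-- The element `x t` of the Rees algebra `A[Jt]`, for `x ∈ J`. -/
def degreeOne (J : Ideal A) (x : J) : Rees J :=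
  (⟨monomial 1 (x : A), reesAlgebra.monomial_mem.mpr (by rw [pow_one]; exact x.2)⟩ : reesAlgebra J)

/-- `x_1, …, x_l` in `J` is super-regular with respect to `J`: the sequence `x_1 t, …, x_l t` of
elements of `A[Jt]` is regular on `gr_J(A)`. -/
def IsSuperRegularSequence (J : Ideal A) (xs : List J) : Prop :=
  RingTheory.Sequence.IsRegular (AssociatedGraded J) (xs.map (degreeOne J))

/-- `x` is a super-regular element of `A` with respect to `J`. -/
def IsSuperRegular (J : Ideal A) (x : A) : Prop :=
  ∃ hx : x ∈ J, IsSuperRegularSequence J [⟨x, hx⟩]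

/-- For a subalgebra `B` of `A[t]`, the `A[Qt]`-submodule of `A[t]` generated by `J B`. When `B`
contains `A[Qt]`, this is the ideal `J B` of `B` itself. -/
def idealMul (Q J : Ideal A) (B : Subalgebra A A[X]) : Submodule (Rees Q) A[X] :=
  Submodule.span (Rees Q) {f | ∃ c ∈ J, ∃ g ∈ B, f = C c * g}

/-- The Sally module `S_Q(J) = J R(J) / J R(Q)`, a module over `R(Q) = A[Qt]` (for `Q ⊆ J`). -/
abbrev SallyModule (Q J : Ideal A) : Type u :=
  idealMul Q J (reesAlgebra J) ⧸
    (idealMul Q J (reesAlgebra Q)).submoduleOf (idealMul Q J (reesAlgebra J))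

/-- The homogeneous component of degree `i` of the Sally module (`J^{i+1} / J Q^i`), as the set of
classes of the monomials `c t^i` of `J R(J)`. -/
def sallyComponent (Q J : Ideal A) (i : ℕ) : Set (SallyModule Q J) :=
  {s | ∃ (c : A) (h : monomial i c ∈ idealMul Q J (reesAlgebra J)),
    s = Submodule.Quotient.mk ⟨monomial i c, h⟩}

/-- The Sally module is generated over `R(Q)` by its homogeneous elements of degree one. -/
def SallyGeneratedInDegreeOne (Q J : Ideal A) : Prop :=
  Submodule.span (Rees Q) (sallyComponent Q J 1) = ⊤

/-- The extension `m R(Q)` of the maximal ideal `m` of `A` to `R(Q)`. -/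
def maxExtension [IsLocalRing A] (Q : Ideal A) : Ideal (Rees Q) :=
  (IsLocalRing.maximalIdeal A).map (algebraMap A (Rees Q))

/-- The rank of the Sally module is `n`: `p = m R(Q)` is a prime ideal of `R(Q)` and the
localization of the Sally module at `p` has length `n` over `R(Q)_p`. -/
def SallyRankEq [IsLocalRing A] (Q J : Ideal A) (n : ℕ) : Prop :=
  ∃ _ : (maxExtension Q).IsPrime,
    Module.length (Localization (maxExtension Q).primeCompl)
      (LocalizedModule (maxExtension Q).primeCompl (SallyModule Q J)) = n

/-- `A`, a Cohen-Macaulay local ring with canonical ideal `I`, is an `n`-Goto ring with respect to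
`Q`, where `Q` is a parameter ideal that satisfies `(♯)`: with `J = I + Q`, the Sally module
`S_Q(J)` is generated in degree one and has rank `n`. -/
structure IsGotoWithRespectTo [IsCohenMacaulayLocalRing A] (I Q : Ideal A) (n : ℕ) : Prop where
  isCanonicalIdeal : IsCanonicalIdeal I
  satisfiesSharp : SatisfiesSharp I Q
  generated : SallyGeneratedInDegreeOne Q (I ⊔ Q)
  rank_eq : SallyRankEq Q (I ⊔ Q) n

end

end GotoRing

/-! Since `x ∉ 𝔪𝔮`, it can replace some `a_j` with `j ≠ 0` without changing `Q` or `a_0`, so `x` may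
be taken to be a parameter `a_j`. It is then regular on `A`. It is also regular modulo `I`, because
`I` is maximal Cohen-Macaulay and contains another parameter. Hence the image of `I` in `A/(x)` is
`I/xI`, and Rees's isomorphism `Ext^n_{A/(x)}(N, I/xI) ≅ Ext^{n+1}_A(N, I)` (`extShift_bijective`)
shows that this image is again canonical.

For the Sally module `S`, two colon formulas matter. Super-regularity gives `J^{i+1} : x = J^i`, so
the Sally module of `A/(x)` is `S/(xt)S` (`sallyCokerMap_bijective`). Parameters of a Cohen-Macaulay
ring are a regular sequence in every order, which gives `JQ^{i+1} : x = JQ^i`, so `xt` is a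
nonzerodivisor on `S`.

Generation in degree one means `J^3 ⊆ QJ^2` (`sallyGeneratedInDegreeOne_iff`), which passes to
`A/(x)` and back by the first formula. For the ranks, let `p = 𝔪R(Q)`. It is prime by analytic
independence, and the corresponding prime over `A/(x)` pulls back to `q = p + (xt)`. A power of `p`
kills `S`, and the associativity formula `ℓ((S/yS)_q) = ℓ(S_p) + ℓ((0 :_S y)_q)` for `y = xt`
(`localLength_smulCoker`) has vanishing last term. So the two ranks agree. -/

namespace GotoRing

open IsLocalRing RingTheory.Sequence Pointwise

/-! ### Depth, Krull dimension and regular sequences. -/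

section Depth

variable {A : Type u} [CommRing A] [IsLocalRing A] {M : Type u} [AddCommGroup M] [Module A M]

lemma mem_maximalIdeal_of_isRegular {rs : List A} (h : IsRegular M rs) :
    ∀ r ∈ rs, r ∈ maximalIdeal A := by
  intro r hr
  rw [mem_maximalIdeal, mem_nonunits_iff]
  intro hu
  apply h.top_ne_smul
  have : Ideal.ofList rs = ⊤ :=
    Ideal.eq_top_of_isUnit_mem _ (Ideal.subset_span hr) hu
  rw [this, Submodule.top_smul]

variable [IsNoetherianRing A] [Module.Finite A M]

/-- Regular sequences of a given length exist exactly when the `Ext` groups below that degree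
vanish, and this vanishing passes to `M/xM` by the long exact sequence. So any regular `x ∈ 𝔪`
lowers the depth by at most one, not only the head of a chosen sequence. -/
lemma exists_isRegular_quotSMulTop {x : A} (hx : x ∈ maximalIdeal A) (reg : IsSMulRegular M x)
    {r : ℕ} (h : ∃ rs : List A, IsRegular M rs ∧ rs.length = r + 1) :
    ∃ rs : List A, IsRegular (QuotSMulTop x M) rs ∧ rs.length = r := by
  obtain ⟨rs, hrs, hlen⟩ := h
  have : Nontrivial M := hrs.nontrivial
  have lt : ∀ (N : ModuleCat.{u} A) [Module.Finite A N] [Nontrivial N],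
      maximalIdeal A • (⊤ : Submodule A N) < ⊤ := by
    intro N _ _
    refine lt_top_iff_ne_top.mpr fun h ↦ ?_
    exact (top_ne_bot : (⊤ : Submodule A N) ≠ ⊥)
      (Submodule.eq_bot_of_le_smul_of_le_jacobson_bot _ _ Module.Finite.fg_top h.ge
        (IsLocalRing.maximalIdeal_le_jacobson ⊥))
  have ext1 := ((ModuleCat.exists_isRegular_tfae (maximalIdeal A) (r + 1) (ModuleCat.of A M)
    (lt _)).out 3 1 rfl rfl).mp ⟨rs, hlen, mem_maximalIdeal_of_isRegular hrs, hrs⟩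
  have : Nontrivial (QuotSMulTop x M) := nontrivial_quotSMulTop_of_mem_maximalIdeal M hx
  obtain ⟨rs', h1, h2, h3⟩ := ((ModuleCat.exists_isRegular_tfae (maximalIdeal A) r
    (ModuleCat.of A (QuotSMulTop x M)) (lt _)).out 1 3).mp (by
      intro i hi
      have zero1 := AddCommGrpCat.isZero_of_iff_subsingleton.mpr (ext1 i (by omega))
      have zero2 := AddCommGrpCat.isZero_of_iff_subsingleton.mpr (ext1 (i + 1) (by omega))
      exact AddCommGrpCat.subsingleton_of_isZero <| ShortComplex.Exact.isZero_of_both_zeros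
        ((Abelian.Ext.covariant_sequence_exact₃' _
          (IsSMulRegular.smulShortComplex_shortExact (M := ModuleCat.of A M) reg)) i (i + 1) rfl)
        (zero1.eq_zero_of_src _) (zero2.eq_zero_of_tgt _))
  exact ⟨rs', h3, h1⟩

/-- Depth is bounded by the dimension of any associated prime. Pick such a prime `P ⊇ K`. The
submodule `N` of elements killed by `P` is nonzero and not inside `xM`, so `M/xM` has a nonzero
element killed by `P + (x)`. As `x ∉ P`, passing to `A/(P + (x))` costs at least one dimension, and
induction applies. -/
lemma length_le_ringKrullDim_quotient {r : ℕ} (h : ∃ rs : List A, IsRegular M rs ∧ rs.length = r)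
    {K : Ideal A} {v : M} (hv : v ≠ 0) (hK : ∀ k ∈ K, k • v = 0) :
    (r : WithBot ℕ∞) ≤ ringKrullDim (A ⧸ K) := by
  obtain ⟨rs, hrs, rfl⟩ := h
  induction rs generalizing M K with
  | nil =>
    have : Nontrivial (A ⧸ K) := Ideal.Quotient.nontrivial_iff.mpr fun h ↦
      hv (by simpa using hK 1 (h ▸ trivial))
    simpa using ringKrullDim_nonneg_of_nontrivial
  | cons x rs ih =>
    have hxm : x ∈ maximalIdeal A := mem_maximalIdeal_of_isRegular hrs x (by simp)
    rw [isRegular_cons_iff] at hrs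
    obtain ⟨P, hP, hPv⟩ := exists_le_isAssociatedPrime_of_isNoetherianRing A v hv
    have hKP : K ≤ P := fun k hk ↦ hPv (by simpa [Submodule.mem_colon_singleton] using hK k hk)
    obtain ⟨hPp, w, hw⟩ := isAssociatedPrime_iff.mp hP
    have hw0 : w ≠ 0 := by
      rintro rfl
      exact hPp.ne_top (by rw [hw]; ext; simp [Submodule.mem_colon_singleton])
    let N : Submodule A M := ⨅ p : P, LinearMap.ker (LinearMap.lsmul A M p)
    have memN : ∀ u, u ∈ N ↔ ∀ p ∈ P, p • u = 0 := by
      intro u; simp [N, Submodule.mem_iInf]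
    have : ∃ u ∈ N, u ∉ x • (⊤ : Submodule A M) := by
      by_contra! hcon
      have hwN : w ∈ N := (memN w).mpr fun p hp ↦ by
        rw [hw] at hp; simpa [Submodule.mem_colon_singleton] using hp
      -- If `N ⊆ xM`, regularity of `x` puts the cofactor back in `N`, so `N = xN` and Nakayama
      -- kills `N`.
      have hN : N ≤ (Ideal.span {x}) • N := by
        intro u hu
        obtain ⟨u', -, hu'⟩ := (Submodule.mem_smul_pointwise_iff_exists _ _ _).mp (hcon u hu)
        rw [Submodule.ideal_span_singleton_smul]
        refine (Submodule.mem_smul_pointwise_iff_exists _ _ _).mpr ⟨u', ?_, hu'⟩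
        rw [memN] at hu ⊢
        intro p hp
        apply hrs.1
        have := hu p hp
        rw [← hu', smul_comm] at this
        simpa using this
      have := Submodule.eq_bot_of_le_smul_of_le_jacobson_bot _ _ (IsNoetherian.noetherian N) hN
        (((Ideal.span_singleton_le_iff_mem _).mpr hxm).trans
          (IsLocalRing.maximalIdeal_le_jacobson ⊥))
      rw [this] at hwN
      exact hw0 ((Submodule.mem_bot A).mp hwN)
    obtain ⟨u, huN, hux⟩ := this
    rw [memN] at huN
    have hu0 : (Submodule.Quotient.mk u : QuotSMulTop x M) ≠ 0 := by
      simpa [Submodule.Quotient.mk_eq_zero] using hux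
    have key := ih (K := P ⊔ Ideal.span {x}) hu0 (hrs := hrs.2) (by
      intro k hk
      obtain ⟨p, hp, y, hy, rfl⟩ := Submodule.mem_sup.mp hk
      obtain ⟨c, rfl⟩ := Ideal.mem_span_singleton.mp hy
      rw [add_smul, ← Submodule.Quotient.mk_smul, huN p hp, ← Submodule.Quotient.mk_smul,
        Submodule.Quotient.mk_zero, zero_add, Submodule.Quotient.mk_eq_zero, mul_smul]
      exact Submodule.smul_mem_pointwise_smul _ _ _ trivial)
    have hxP : x ∉ P := by
      intro hxP
      apply hw0
      apply hrs.1
      rw [hw] at hxP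
      simpa [Submodule.mem_colon_singleton] using hxP
    have h1 : ringKrullDim (A ⧸ P ⊔ Ideal.span {x}) + 1 ≤ ringKrullDim (A ⧸ P) := by
      refine ringKrullDim_succ_le_of_surjective (Ideal.Quotient.factor le_sup_left)
        (Ideal.Quotient.factor_surjective _) (r := Ideal.Quotient.mk P x) ?_ ?_
      · rw [mem_nonZeroDivisors_iff_ne_zero]
        rwa [ne_eq, Ideal.Quotient.eq_zero_iff_mem]
      · rw [Ideal.Quotient.factor_mk, Ideal.Quotient.eq_zero_iff_mem]
        exact Ideal.mem_sup_right (Ideal.mem_span_singleton_self x)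
    have h2 : ringKrullDim (A ⧸ P) ≤ ringKrullDim (A ⧸ K) :=
      ringKrullDim_le_of_surjective (Ideal.Quotient.factor hKP)
        (Ideal.Quotient.factor_surjective _)
    refine le_trans ?_ (h1.trans h2)
    simp only [List.length_cons, Nat.cast_add, Nat.cast_one]
    gcongr

lemma ringKrullDim_quotient_le_length {K : Ideal A} {l : List A}
    (hlm : ∀ a ∈ l, a ∈ maximalIdeal A)
    (h : maximalIdeal A ≤ (K ⊔ Ideal.ofList l).radical) :
    ringKrullDim (A ⧸ K) ≤ (l.length : WithBot ℕ∞) := by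
  classical
  rcases eq_or_ne K ⊤ with rfl | hKt
  · have : Subsingleton (A ⧸ (⊤ : Ideal A)) := Ideal.Quotient.subsingleton_iff.mpr rfl
    rw [ringKrullDim_eq_bot_of_subsingleton]; exact bot_le
  have : Nontrivial (A ⧸ K) := Ideal.Quotient.nontrivial_iff.mpr hKt
  have : IsLocalRing (A ⧸ K) :=
    IsLocalRing.of_surjective' (Ideal.Quotient.mk K) Ideal.Quotient.mk_surjective
  set s : Finset (A ⧸ K) := (l.map (Ideal.Quotient.mk K)).toFinset with hs
  have hle := ringKrullDim_le_ringKrullDim_quotient_add_card s (by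
    intro b hb
    simp only [hs, List.coe_toFinset, List.mem_map, Set.mem_ofPred_eq] at hb
    obtain ⟨a, ha, rfl⟩ := hb
    rw [IsLocalRing.ringJacobson_eq_maximalIdeal]
    have := IsLocalHom.of_surjective (Ideal.Quotient.mk K) Ideal.Quotient.mk_surjective
    exact (map_mem_nonunits_iff (Ideal.Quotient.mk K) a).mpr (hlm a ha))
  have hcard : s.card ≤ l.length := (List.toFinset_card_le _).trans (by simp)
  have h0 : ringKrullDim ((A ⧸ K) ⧸ Ideal.span (s : Set (A ⧸ K))) ≤ 0 := by
    have hspan : Ideal.span (s : Set (A ⧸ K)) = (Ideal.ofList l).map (Ideal.Quotient.mk K) := by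
      rw [Ideal.ofList, Ideal.map_span]
      congr 1
      ext; simp [hs]
    suffices Ring.KrullDimLE 0 ((A ⧸ K) ⧸ Ideal.span (s : Set (A ⧸ K))) from
      (Order.krullDimLE_iff _ _).mp this
    rw [Ring.krullDimLE_zero_iff]
    intro p hp
    let f : A →+* (A ⧸ K) ⧸ Ideal.span (s : Set (A ⧸ K)) :=
      (Ideal.Quotient.mk _).comp (Ideal.Quotient.mk K)
    have hf : Function.Surjective f :=
      Ideal.Quotient.mk_surjective.comp Ideal.Quotient.mk_surjective
    have hm : maximalIdeal A ≤ p.comap f := by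
      refine h.trans ((Ideal.IsPrime.radical_le_iff (hp.comap f)).mpr ?_)
      refine le_trans ?_ (Ideal.comap_mono (bot_le (a := p)))
      rw [sup_le_iff]
      constructor
      · intro k hk
        simp [f, Ideal.Quotient.eq_zero_iff_mem.mpr hk]
      · intro k hk
        rw [Ideal.mem_comap, Ideal.mem_bot]
        exact Ideal.Quotient.eq_zero_iff_mem.mpr (hspan ▸ Ideal.mem_map_of_mem _ hk)
    have : (p.comap f).IsMaximal := by
      rw [← (maximalIdeal.isMaximal A).eq_of_le (hp.comap f).ne_top hm]
      exact maximalIdeal.isMaximal A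
    have h := Ideal.map_eq_top_or_isMaximal_of_surjective f hf this
    rw [Ideal.map_comap_of_surjective f hf] at h
    exact h.resolve_left hp.ne_top
  calc ringKrullDim (A ⧸ K) ≤ _ := hle
    _ ≤ 0 + (l.length : WithBot ℕ∞) := by gcongr
    _ = _ := zero_add _

/-- A sequence that is as long as some `M`-regular sequence and whose members generate, together
with some ideal annihilating `M`, an ideal primary to the maximal ideal is `M`-regular. -/
theorem isWeaklyRegular_of_maximalIdeal_le_radical {l : List A} (hlm : ∀ a ∈ l, a ∈ maximalIdeal A)
    {K : Ideal A} (hK : ∀ k ∈ K, ∀ v : M, k • v = 0)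
    (hrad : maximalIdeal A ≤ (K ⊔ Ideal.ofList l).radical)
    (h : ∃ rs : List A, IsRegular M rs ∧ rs.length = l.length) : IsWeaklyRegular M l := by
  induction l generalizing M K with
  | nil => exact IsWeaklyRegular.nil _ _
  | cons x l ih =>
    have hrad' : maximalIdeal A ≤ (K ⊔ Ideal.span {x} ⊔ Ideal.ofList l).radical := by
      rwa [Ideal.ofList_cons, ← sup_assoc] at hrad
    have reg : IsSMulRegular M x := by
      rw [isSMulRegular_iff_right_eq_zero_of_smul]
      intro v hv
      by_contra hv0
      -- If `x` killed some `v ≠ 0`, then `K + (x)` would kill it too. The dimension of `A/(K +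
      -- (x))` would be at least `l.length + 1`, although the members of `l` cut it down to zero.
      have h1 := length_le_ringKrullDim_quotient h hv0 (K := K ⊔ Ideal.span {x}) (by
        intro k hk
        obtain ⟨p, hp, y, hy, rfl⟩ := Submodule.mem_sup.mp hk
        obtain ⟨c, rfl⟩ := Ideal.mem_span_singleton.mp hy
        rw [add_smul, hK p hp, zero_add, mul_comm, mul_smul, hv, smul_zero])
      have h2 := ringKrullDim_quotient_le_length (fun a ha ↦ hlm a (by simp [ha])) hrad'
      have := h1.trans h2
      simp only [List.length_cons] at this
      norm_cast at this
      omega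
    rw [isWeaklyRegular_cons_iff]
    refine ⟨reg, ih (fun a ha ↦ hlm a (by simp [ha])) (K := K ⊔ Ideal.span {x}) ?_ hrad'
      (exists_isRegular_quotSMulTop (hlm x (by simp)) reg h)⟩
    intro k hk v
    obtain ⟨p, hp, y, hy, rfl⟩ := Submodule.mem_sup.mp hk
    obtain ⟨c, rfl⟩ := Ideal.mem_span_singleton.mp hy
    obtain ⟨v, rfl⟩ := Submodule.Quotient.mk_surjective _ v
    rw [← Submodule.Quotient.mk_smul, Submodule.Quotient.mk_eq_zero, add_smul, hK p hp, zero_add,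
      mul_smul]
    exact Submodule.smul_mem_pointwise_smul _ _ _ trivial

end Depth

/-! ### Permutable regular sequences and colon ideals of powers. -/

section Permutable

variable {A : Type u} [CommRing A] {ι : Type*}

/-- Every `a j` with `j ∈ U` is regular modulo the ideal generated by `K` and any of the other
`a i` with `i ∈ U`. -/
def IsPermutableRegular (K : Ideal A) (U : Set ι) (a : ι → A) : Prop :=
  ∀ s ⊆ U, ∀ j ∈ U, j ∉ s → ∀ c, a j * c ∈ K ⊔ Ideal.span (a '' s) → c ∈ K ⊔ Ideal.span (a '' s)

lemma IsPermutableRegular.mono {K : Ideal A} {U V : Set ι} {a : ι → A}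
    (h : IsPermutableRegular K U a) (hV : V ⊆ U) : IsPermutableRegular K V a :=
  fun s hs j hj ↦ h s (hs.trans hV) j (hV hj)

lemma IsPermutableRegular.sup_span {K : Ideal A} {U : Set ι} {j : ι} {a : ι → A}
    (h : IsPermutableRegular K (insert j U) a) (hj : j ∉ U) :
    IsPermutableRegular (K ⊔ Ideal.span {a j}) U a := by
  intro s hs i hi his c hc
  have := h (insert j s) (Set.insert_subset_insert hs) i (Set.mem_insert_of_mem _ hi) (by
    rintro (rfl | h)
    · exact hj hi
    · exact his h) c
  rw [Set.image_insert_eq, Ideal.span_insert, ← sup_assoc] at this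
  exact this hc

lemma IsPermutableRegular.quotient {K : Ideal A} {U : Set ι} {a : ι → A}
    (h : IsPermutableRegular K U a) :
    IsPermutableRegular ⊥ U (fun i ↦ Ideal.Quotient.mk K (a i)) := by
  intro s hs j hj hjs c hc
  obtain ⟨c, rfl⟩ := Ideal.Quotient.mk_surjective c
  have key : ∀ c, Ideal.Quotient.mk K c ∈ ⊥ ⊔ Ideal.span ((fun i ↦ Ideal.Quotient.mk K (a i)) '' s)
      ↔ c ∈ K ⊔ Ideal.span (a '' s) := by
    intro c
    rw [bot_sup_eq, sup_comm, ← Ideal.mem_quotient_iff_mem_sup, Ideal.map_span, Set.image_image]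
  rw [← map_mul, key] at hc
  exact (key c).mpr (h s hs j hj hjs c hc)

lemma sup_pow_succ_eq (X Y : Ideal A) (n : ℕ) :
    (X ⊔ Y) ^ (n + 1) = X * (X ⊔ Y) ^ n ⊔ Y ^ (n + 1) := by
  induction n with
  | zero => simp
  | succ n ih =>
    apply le_antisymm
    · rw [pow_succ', Ideal.sup_mul]
      refine sup_le le_sup_left ?_
      conv_lhs => rw [ih, Ideal.mul_sup]
      refine sup_le (le_sup_of_le_left ?_) (le_sup_of_le_right (pow_succ' Y (n + 1)).ge)
      rw [mul_left_comm, pow_succ' (X ⊔ Y) n]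
      gcongr
      exact le_sup_right
    · refine sup_le ?_ (Ideal.pow_right_mono le_sup_right _)
      rw [pow_succ' (X ⊔ Y) (n + 1)]
      gcongr
      exact le_sup_left

/-- A member of a permutable regular sequence is regular modulo the powers of the ideal generated
by the other members. -/
theorem IsPermutableRegular.mem_of_mul_mem_pow {s : Finset ι} {j : ι} (hj : j ∉ s) {a : ι → A}
    {K : Ideal A} (h : IsPermutableRegular K (insert j (s : Set ι)) a) (n : ℕ) {c : A}
    (hc : a j * c ∈ K ⊔ Ideal.span (a '' (s : Set ι)) ^ n) :
    c ∈ K ⊔ Ideal.span (a '' (s : Set ι)) ^ n := by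
  classical
  induction s using Finset.induction_on generalizing K j n c with
  | empty =>
    cases n with
    | zero => simp
    | succ n =>
      have := h ∅ (Set.empty_subset _) j (Set.mem_insert _ _) (by simp) c
      simpa using this (by simpa using hc)
  | insert b s hb ih =>
    have hjb : j ≠ b := fun h ↦ hj (by simp [h])
    have hjs : j ∉ s := fun h ↦ hj (by simp [h])
    have hspan : Ideal.span (a '' ((insert b s : Finset ι) : Set ι)) =
        Ideal.span {a b} ⊔ Ideal.span (a '' (s : Set ι)) := by
      rw [Finset.coe_insert, Set.image_insert_eq, Ideal.span_insert]
    set X := Ideal.span {a b} with hX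
    set Y := Ideal.span (a '' (s : Set ι)) with hY
    rw [hspan] at hc ⊢
    -- The outer hypothesis is used twice with fewer generators: for `a j` modulo `K + (a b)`, and
    -- for `a b` itself modulo `K`.
    have ih1 := @ih j hjs (K ⊔ X) (IsPermutableRegular.sup_span (U := insert j (s : Set ι))
      (by rwa [Set.insert_comm, ← Finset.coe_insert]) (by simp [hjb.symm, hb]))
    have ih2 := @ih b hb K (h.mono (by
      rw [Finset.coe_insert]; exact Set.subset_insert _ _))
    induction n generalizing c with
    | zero => simp
    | succ n ihn =>
      have h1 : c ∈ K ⊔ X ⊔ Y ^ (n + 1) := by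
        apply ih1
        suffices K ⊔ (X ⊔ Y) ^ (n + 1) ≤ K ⊔ X ⊔ Y ^ (n + 1) from this hc
        rw [sup_pow_succ_eq, ← sup_assoc]
        exact sup_le_sup_right (sup_le_sup_left Ideal.mul_le_left _) _
      have hYle : K ⊔ Y ^ (n + 1) ≤ K ⊔ (X ⊔ Y) ^ (n + 1) := by
        gcongr; exact le_sup_right
      obtain ⟨w, hw, z, hz, rfl⟩ := Submodule.mem_sup.mp h1
      obtain ⟨k, hk, y, hy, rfl⟩ := Submodule.mem_sup.mp hw
      obtain ⟨t, rfl⟩ := Ideal.mem_span_singleton'.mp hy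
      have h2 : a j * (t * a b) ∈ K ⊔ (X ⊔ Y) ^ (n + 1) := by
        have h3 : a j * (k + z) ∈ K ⊔ (X ⊔ Y) ^ (n + 1) :=
          Ideal.mul_mem_left _ _ (hYle (Submodule.add_mem_sup hk hz))
        have := Ideal.sub_mem _ hc h3
        convert this using 1
        ring
      -- Now `c` is `t * a b` up to `K + Y^(n+1)`. Splitting `(X + Y)^(n+1)` as `X(X + Y)^n +
      -- Y^(n+1)` allows `a b` to be cancelled by `ih2`. What remains is `a j * t ∈ K + (X + Y)^n`,
      -- one power lower.
      have h4 : t ∈ K ⊔ (X ⊔ Y) ^ n := by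
        apply ihn
        rw [sup_pow_succ_eq] at h2
        obtain ⟨k', hk', v, hv, h2⟩ := Submodule.mem_sup.mp h2
        obtain ⟨v₁, hv₁, v₂, hv₂, rfl⟩ := Submodule.mem_sup.mp hv
        obtain ⟨v₃, hv₃, rfl⟩ := Ideal.mem_span_singleton_mul.mp hv₁
        have h5 : a j * t - v₃ ∈ K ⊔ Y ^ (n + 1) := by
          apply ih2
          have : a b * (a j * t - v₃) = k' + v₂ := by linear_combination -h2
          rw [this]
          exact Submodule.add_mem_sup hk' hv₂
        have h6 : a j * t - v₃ ∈ K ⊔ (X ⊔ Y) ^ n :=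
          (hYle.trans (sup_le_sup_left (Ideal.pow_le_pow_right n.le_succ) _)) h5
        have := Ideal.add_mem _ h6 ((le_sup_right : _ ≤ K ⊔ (X ⊔ Y) ^ n) hv₃)
        rwa [sub_add_cancel] at this
      rw [add_right_comm]
      refine Ideal.add_mem _ (hYle (Submodule.add_mem_sup hk hz)) ?_
      obtain ⟨k₁, hk₁, t₁, ht₁, rfl⟩ := Submodule.mem_sup.mp h4
      rw [add_mul]
      refine Submodule.add_mem_sup (Ideal.mul_mem_right _ _ hk₁) ?_
      rw [pow_succ]
      exact Ideal.mul_mem_mul ht₁ (Ideal.mem_sup_left (Ideal.mem_span_singleton_self _))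

/-- `x ∈ Q`, and for all ideals `J` containing `Q` the colon ideal `J Q ^ (i + 1) : x` is
`J Q ^ i`. For `J = A` this says that the leading form of `x` in the associated graded ring of `Q`
is regular of degree one. -/
structure IsSuperficialRegular (Q : Ideal A) (x : A) : Prop where
  mem : x ∈ Q
  mem_of_mul_mem : ∀ J, Q ≤ J → ∀ i c, x * c ∈ J * Q ^ (i + 1) → c ∈ J * Q ^ i

/-- With `Q = (x) + Y` one has `JQ^{i+1} = xJQ^i + JY^{i+1}`. Subtracting the first part leaves a
multiple of `x` in `Y^{i+1}`; its cofactor lies there as well, and `Y^{i+1} ⊆ JQ^i` because `Y ⊆ J`.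
-/
lemma isSuperficialRegular_of_pow {x : A} {Y : Ideal A}
    (h : ∀ n c, x * c ∈ Y ^ n → c ∈ Y ^ n) : IsSuperficialRegular (Ideal.span {x} ⊔ Y) x where
  mem := Ideal.mem_sup_left (Ideal.mem_span_singleton_self _)
  mem_of_mul_mem J hJ i c hc := by
    have hY : Y ≤ J := le_sup_right.trans hJ
    rw [sup_pow_succ_eq, Ideal.mul_sup, mul_left_comm] at hc
    obtain ⟨v, hv, u, hu, hc⟩ := Submodule.mem_sup.mp hc
    obtain ⟨v, hv', rfl⟩ := Ideal.mem_span_singleton_mul.mp hv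
    have hu' : u ∈ Y ^ (i + 1) := (Ideal.mul_le_right : J * Y ^ (i + 1) ≤ _) hu
    have h1 : c - v ∈ Y ^ (i + 1) := h _ _ (by
      rwa [show x * (c - v) = u by linear_combination -hc])
    have h2 : Y ^ (i + 1) ≤ J * (Ideal.span {x} ⊔ Y) ^ i := by
      rw [pow_succ']
      exact Ideal.mul_mono hY (Ideal.pow_right_mono le_sup_right _)
    have := Ideal.add_mem _ (h2 h1) hv'
    rwa [sub_add_cancel] at this

lemma IsPermutableRegular.isSuperficialRegular {s : Finset ι} {j : ι} (hj : j ∉ s) {a : ι → A}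
    (h : IsPermutableRegular ⊥ (insert j (s : Set ι)) a) :
    IsSuperficialRegular (Ideal.span (a '' insert j (s : Set ι))) (a j) := by
  rw [Set.image_insert_eq, Ideal.span_insert]
  refine isSuperficialRegular_of_pow fun n c hc ↦ ?_
  have := h.mem_of_mul_mem_pow hj n (c := c)
  simpa using this (by simpa using hc)

end Permutable

/-! ### Systems of parameters in a Cohen-Macaulay local ring. -/

section CohenMacaulay

variable {A : Type u} [CommRing A]

lemma IsSystemOfParameters.mem_maximalIdeal [IsLocalRing A] {d : ℕ} {a : Fin d → A}
    (ha : IsSystemOfParameters a) (i : Fin d) : a i ∈ maximalIdeal A :=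
  ha.radical_eq ▸ Ideal.le_radical (Ideal.subset_span ⟨i, rfl⟩)

/-- Any ordering of the parameters is a regular sequence, so one may list first `s`, then `j`, then
the others. -/
theorem IsSystemOfParameters.isPermutableRegular [IsCohenMacaulayLocalRing A] {d : ℕ}
    {a : Fin d → A} (ha : IsSystemOfParameters a) : IsPermutableRegular ⊥ Set.univ a := by
  classical
  intro S _ j _ hjS c hc
  obtain ⟨s, rfl⟩ := S.toFinite.exists_finset_coe
  set l₁ := s.toList.map a with hl₁
  set l₂ := ((Finset.univ \ insert j s).toList.map a) with hl₂
  have hof : Ideal.ofList l₁ = Ideal.span (a '' (s : Set (Fin d))) := by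
    rw [Ideal.ofList]; congr 1; ext; simp [hl₁]
  obtain ⟨rs, hrs, hlen⟩ := IsCohenMacaulayLocalRing.exists_isRegular (A := A)
  have hjs : j ∉ s := by simpa using hjS
  have hl : IsWeaklyRegular A (l₁ ++ a j :: l₂) := by
    refine isWeaklyRegular_of_maximalIdeal_le_radical (K := ⊥) ?_ (by simp) ?_ ⟨rs, hrs, ?_⟩
    · intro b hb
      simp only [hl₁, hl₂, List.mem_append, List.mem_map, List.mem_cons] at hb
      rcases hb with ⟨i, -, rfl⟩ | rfl | ⟨i, -, rfl⟩ <;> exact ha.mem_maximalIdeal _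
    · rw [bot_sup_eq, ← ha.radical_eq]
      apply Ideal.radical_mono
      rw [Ideal.span_le]
      rintro _ ⟨i, rfl⟩
      apply Ideal.subset_span
      simp only [hl₁, hl₂, List.mem_append, List.mem_map, List.mem_cons, Finset.mem_toList,
        Finset.mem_sdiff, Finset.mem_univ, true_and, Finset.mem_insert, Set.mem_ofPred_eq]
      by_cases h1 : i ∈ s
      · exact Or.inl ⟨i, h1, rfl⟩
      by_cases h2 : i = j
      · exact Or.inr (Or.inl (h2 ▸ rfl))
      · exact Or.inr (Or.inr ⟨i, by simp [h1, h2], rfl⟩)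
    · have h1 : rs.length = d := by
        have := hlen.symm.trans ha.dim_eq
        exact_mod_cast this
      have h2 := Finset.card_sdiff_add_card_eq_card (Finset.subset_univ (insert j s))
      rw [Finset.card_insert_of_notMem hjs, Finset.card_univ, Fintype.card_fin] at h2
      simp only [hl₁, hl₂, List.length_append, List.length_map, Finset.length_toList,
        List.length_cons]
      omega
  rw [isWeaklyRegular_append_iff, isWeaklyRegular_cons_iff] at hl
  have := hl.2.1
  rw [isSMulRegular_quotient_iff_mem_of_smul_mem] at this
  have key := this c
  rw [smul_eq_mul, smul_eq_mul, Ideal.mul_top, hof] at key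
  simpa using key (by simpa using hc)

/-- A parameter `a j` is regular modulo an ideal `I` that is a maximal Cohen-Macaulay module and
contains another member of the system of parameters. -/
theorem IsSystemOfParameters.mem_of_mul_mem_ideal [IsCohenMacaulayLocalRing A] {d : ℕ}
    {a : Fin d → A} (ha : IsSystemOfParameters a) {I : Ideal A}
    (hI : ∃ rs : List A, IsRegular I rs ∧ ringKrullDim A = (rs.length : WithBot ℕ∞))
    {i j : Fin d} (hij : i ≠ j) (hi : a i ∈ I) {c : A} (hc : a j * c ∈ I) : c ∈ I := by
  classical
  obtain ⟨rs, hrs, hlen⟩ := hI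
  rw [ha.dim_eq] at hlen
  have hlen : d = rs.length := by exact_mod_cast hlen
  obtain ⟨d, rfl⟩ : ∃ e, d = e + 1 := ⟨d - 1, by have := i.pos; omega⟩
  have hreg : ∀ c, a j * c = 0 → c = 0 := by
    intro c hc
    simpa using ha.isPermutableRegular ∅ (Set.empty_subset _) j trivial (by simp) c (by simp [hc])
  have hregI : IsSMulRegular I (a j) := by
    rw [isSMulRegular_iff_right_eq_zero_of_smul]
    intro v hv
    ext
    exact hreg _ (by simpa using congrArg Subtype.val hv)
  have hdepth := exists_isRegular_quotSMulTop (ha.mem_maximalIdeal j) hregI (r := d)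
    ⟨rs, hrs, hlen.symm⟩
  by_contra hcI
  let u : I := ⟨a j * c, hc⟩
  -- If `c ∉ I`, the class of `a j * c` in `I/(a j)I` is nonzero and killed by both `a i` and `a j`.
  -- But this module has depth `d`, while `A/(a i, a j)` has dimension at most `d - 1`, as there are
  -- `d + 1` parameters here.
  have hu : (Submodule.Quotient.mk u : QuotSMulTop (a j) I) ≠ 0 := by
    rw [ne_eq, Submodule.Quotient.mk_eq_zero, Submodule.mem_smul_pointwise_iff_exists]
    rintro ⟨v, -, hv⟩
    have h1 : a j * (v : A) = a j * c := by simpa using congrArg Subtype.val hv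
    have h2 : (v : A) - c = 0 := hreg _ (by linear_combination h1)
    exact hcI (sub_eq_zero.mp h2 ▸ v.2)
  have h1 := length_le_ringKrullDim_quotient hdepth hu (K := Ideal.span {a i, a j}) (by
    suffices Ideal.span {a i, a j} ≤
        LinearMap.ker (LinearMap.toSpanSingleton A _ (Submodule.Quotient.mk u)) from
      fun k hk ↦ by simpa using this hk
    rw [Ideal.span_le]
    rintro k (rfl | rfl)
    · rw [SetLike.mem_coe, LinearMap.mem_ker, LinearMap.toSpanSingleton_apply,
        ← Submodule.Quotient.mk_smul, Submodule.Quotient.mk_eq_zero]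
      refine (Submodule.mem_smul_pointwise_iff_exists _ _ _).mpr
        ⟨⟨a i * c, I.mul_mem_right _ hi⟩, trivial, ?_⟩
      ext
      simp [u, mul_left_comm]
    · rw [SetLike.mem_coe, LinearMap.mem_ker, LinearMap.toSpanSingleton_apply,
        ← Submodule.Quotient.mk_smul, Submodule.Quotient.mk_eq_zero]
      exact Submodule.smul_mem_pointwise_smul _ _ _ trivial)
  set l := ((Finset.univ \ {i, j}).toList.map a) with hl
  have h2 := ringKrullDim_quotient_le_length (K := Ideal.span {a i, a j}) (l := l) (by
    intro b hb
    simp only [hl, List.mem_map] at hb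
    obtain ⟨k, -, rfl⟩ := hb
    exact ha.mem_maximalIdeal k) (by
    rw [← ha.radical_eq]
    apply Ideal.radical_mono
    rw [Ideal.span_le]
    rintro _ ⟨k, rfl⟩
    by_cases h : k = i ∨ k = j
    · exact Ideal.mem_sup_left (Ideal.subset_span (by rcases h with rfl | rfl <;> simp))
    · refine Ideal.mem_sup_right (Ideal.subset_span ?_)
      simp only [hl, List.mem_map, Set.mem_ofPred_eq]
      exact ⟨k, by simpa using h, rfl⟩)
  have h3 := h1.trans h2
  have h4 := Finset.card_sdiff_add_card_eq_card (Finset.subset_univ {i, j})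
  rw [Finset.card_pair hij, Finset.card_univ, Fintype.card_fin] at h4
  simp only [hl, List.length_map, Finset.length_toList] at h3
  norm_cast at h3
  omega

end CohenMacaulay

/-! ### Rees's theorem: shifting `Ext` along `A → A/(x)`. -/

section ChangeOfRings

open Abelian

variable {A : Type u} [CommRing A] (x : A)

/-- Restriction of scalars along `A → A / (x)`. -/
noncomputable abbrev restrictQuotient :
    ModuleCat.{u} (A ⧸ Ideal.span {x}) ⥤ ModuleCat.{u} A :=
  ModuleCat.restrictScalars (Ideal.Quotient.mk (Ideal.span {x}))

lemma restrictQuotient_smul_id (N : ModuleCat.{u} (A ⧸ Ideal.span {x})) (a : A) :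
    (restrictQuotient x).map (Ideal.Quotient.mk (Ideal.span {x}) a • 𝟙 N) =
      a • 𝟙 ((restrictQuotient x).obj N) := by
  ext n
  rfl

lemma smul_id_restrictQuotient_eq_zero (N : ModuleCat.{u} (A ⧸ Ideal.span {x})) :
    x • 𝟙 ((restrictQuotient x).obj N) = 0 := by
  rw [← restrictQuotient_smul_id,
    Ideal.Quotient.eq_zero_iff_mem.mpr (Ideal.mem_span_singleton_self x), zero_smul,
    Functor.map_zero]

lemma restrictQuotient_full : (restrictQuotient x).Full where
  map_surjective {N N'} f := by
    refine ⟨ModuleCat.ofHom ⟨f.hom.toAddMonoidHom.toAddHom, fun b n ↦ ?_⟩, ?_⟩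
    · obtain ⟨a, rfl⟩ := Ideal.Quotient.mk_surjective b
      exact f.hom.map_smul a n
    · ext n
      rfl

variable {x}

/-- A basis gives the resolution `0 → A^(ι) → A^(ι) → V → 0` with first map multiplication by `x`.
-/
lemma hasProjectiveDimensionLT_restrictQuotient (hx : IsSMulRegular A x)
    (V : ModuleCat.{u} (A ⧸ Ideal.span {x})) [Module.Free (A ⧸ Ideal.span {x}) V] :
    HasProjectiveDimensionLT ((restrictQuotient x).obj V) 2 := by
  let b := Module.Free.chooseBasis (A ⧸ Ideal.span {x}) V
  let ι := Module.Free.ChooseBasisIndex (A ⧸ Ideal.span {x}) V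
  let W := (restrictQuotient x).obj V
  let g : (ι →₀ A) →ₗ[A] W := Finsupp.linearCombination A (fun i ↦ (b i : V))
  have hg : ∀ f : ι →₀ A, (g f : V) =
      b.repr.symm (f.mapRange (Ideal.Quotient.mk (Ideal.span {x})) (map_zero _)) := by
    intro f
    rw [Module.Basis.repr_symm_apply, Finsupp.linearCombination_apply,
      Finsupp.sum_mapRange_index (by simp)]
    rfl
  have hreg : IsSMulRegular (ι →₀ A) x := by
    rw [isSMulRegular_iff_right_eq_zero_of_smul] at hx ⊢
    intro f hf
    ext i
    exact hx _ (by simpa using DFunLike.congr_fun hf i)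
  have hex : Function.Exact (LinearMap.lsmul A (ι →₀ A) x) g := by
    intro f
    have : g f = (0 : V) ↔ f.mapRange (Ideal.Quotient.mk (Ideal.span {x})) (map_zero _) = 0 := by
      rw [hg]
      exact LinearEquiv.map_eq_zero_iff b.repr.symm
    refine this.trans ?_
    constructor
    · intro h
      have : ∀ i, ∃ c, f i = x * c := fun i ↦ by
        have := DFunLike.congr_fun h i
        rw [Finsupp.mapRange_apply, Finsupp.zero_apply, Ideal.Quotient.eq_zero_iff_mem,
          Ideal.mem_span_singleton] at this
        exact this
      choose c hc using this
      refine ⟨Finsupp.onFinset f.support c fun i hi ↦ ?_, ?_⟩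
      · rw [Finsupp.mem_support_iff, hc]
        intro h0
        exact hi (isSMulRegular_iff_right_eq_zero_of_smul.mp hx _ h0)
      · ext i
        simp [hc i]
    · rintro ⟨f, rfl⟩
      ext i
      simp
  have hsurj : Function.Surjective g := by
    intro v
    obtain ⟨f, hf⟩ := Finsupp.mapRange_surjective (Ideal.Quotient.mk (Ideal.span {x})) (map_zero _)
      Ideal.Quotient.mk_surjective (b.repr (v : V))
    exact ⟨f, (hg f).trans (by rw [hf]; exact b.repr.symm_apply_apply v)⟩
  let S : ShortComplex (ModuleCat.{u} A) := ModuleCat.shortComplexOfCompEqZero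
    (LinearMap.lsmul A (ι →₀ A) x) g hex.linearMap_comp_eq_zero
  have hS : S.ShortExact :=
    { exact := ModuleCat.shortComplex_exact _ hex
      mono_f := (ModuleCat.mono_iff_injective _).mpr hreg
      epi_g := (ModuleCat.epi_iff_surjective _).mpr hsurj }
  have : Module.Free A S.X₁ := Module.Free.finsupp A A ι
  have : Module.Free A S.X₂ := Module.Free.finsupp A A ι
  have h₁ : Projective S.X₁ := ModuleCat.projective_of_free (Module.Free.chooseBasis A S.X₁)
  have h₂ : Projective S.X₂ := ModuleCat.projective_of_free (Module.Free.chooseBasis A S.X₂)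
  exact hS.hasProjectiveDimensionLT_X₃ 1 inferInstance inferInstance

variable {M : ModuleCat.{u} A} {M' : ModuleCat.{u} (A ⧸ Ideal.span {x})}
  {g : M ⟶ (restrictQuotient x).obj M'} {w : (x • 𝟙 M) ≫ g = 0}

/-- The comparison map `Ext^n (N, M') → Ext^{n+1} (N, M)`, the first `Ext` being taken over
`A / (x)`, for an exact sequence `0 → M → M → M' → 0` with multiplication by `x`. -/
noncomputable def extShift (hS : (ShortComplex.mk (x • 𝟙 M) g w).ShortExact)
    (N : ModuleCat.{u} (A ⧸ Ideal.span {x})) (n : ℕ) :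
    Ext N M' n →+ Ext ((restrictQuotient x).obj N) M (n + 1) :=
  (hS.extClass.postcomp ((restrictQuotient x).obj N) rfl).comp
    ((restrictQuotient x).mapExtAddHom N M' n)

lemma extShift_apply (hS : (ShortComplex.mk (x • 𝟙 M) g w).ShortExact)
    (N : ModuleCat.{u} (A ⧸ Ideal.span {x})) (n : ℕ) (e : Ext N M' n) :
    extShift hS N n e = (e.mapExactFunctor (restrictQuotient x)).comp hS.extClass rfl := rfl

lemma extShift_smul (hS : (ShortComplex.mk (x • 𝟙 M) g w).ShortExact)
    (N : ModuleCat.{u} (A ⧸ Ideal.span {x})) (n : ℕ) (a : A) (e : Ext N M' n) :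
    extShift hS N n (Ideal.Quotient.mk (Ideal.span {x}) a • e) = a • extShift hS N n e := by
  have h : Ideal.Quotient.mk (Ideal.span {x}) a • e =
      (Ext.mk₀ (Ideal.Quotient.mk (Ideal.span {x}) a • 𝟙 N)).comp e (zero_add n) := by
    rw [Ext.mk₀_smul, Ext.smul_comp, Ext.mk₀_id_comp]
  rw [extShift_apply, extShift_apply, h, Ext.mapExactFunctor_comp, Ext.mapExactFunctor_mk₀,
    restrictQuotient_smul_id, Ext.mk₀_smul, Ext.smul_comp, Ext.mk₀_id_comp, Ext.smul_comp]

lemma extShift_precomp (hS : (ShortComplex.mk (x • 𝟙 M) g w).ShortExact)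
    {N N' : ModuleCat.{u} (A ⧸ Ideal.span {x})} {m n k : ℕ} (α : Ext N N' m) (e : Ext N' M' n)
    (h : m + n = k) :
    extShift hS N k (α.comp e h) = (α.mapExactFunctor (restrictQuotient x)).comp
      (extShift hS N' n e) (by omega) := by
  rw [extShift_apply, extShift_apply, Ext.mapExactFunctor_comp, Ext.comp_assoc]
  omega

/-- In degree zero, `x` is zero on `N` but regular on `M`, so `Hom(N, M) = 0`, while `x` annihilates
`Ext^1(N, M)`; the long exact sequence does the rest. Higher degrees follow by dimension shifting
along a free cover of `N` over `A/(x)`, whose restriction to `A` has projective dimension at most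
one. -/
theorem extShift_bijective (hx : IsSMulRegular A x)
    (hS : (ShortComplex.mk (x • 𝟙 M) g w).ShortExact)
    (N : ModuleCat.{u} (A ⧸ Ideal.span {x})) (n : ℕ) :
    Function.Bijective (extShift hS N n) := by
  have : (restrictQuotient x).Full := restrictQuotient_full x
  induction n generalizing N with
  | zero =>
    constructor
    · rw [injective_iff_map_eq_zero]
      intro e he
      rw [extShift_apply] at he
      obtain ⟨y, hy⟩ := Ext.covariant_sequence_exact₃ _ hS _ _ he
      obtain ⟨h, rfl⟩ := (Ext.mk₀_bijective _ _).2 y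
      obtain ⟨f, rfl⟩ := (Ext.mk₀_bijective _ _).2 e
      have hm := hS.mono_f
      have h0 : h = 0 := by
        rw [← cancel_mono (x • 𝟙 M), Limits.zero_comp]
        calc h ≫ (x • 𝟙 M) = (x • 𝟙 ((restrictQuotient x).obj N)) ≫ h := by
              rw [Linear.comp_smul, Linear.smul_comp, Category.id_comp]
              exact congrArg (x • ·) (Category.comp_id h)
          _ = 0 := by rw [smul_id_restrictQuotient_eq_zero, Limits.zero_comp]
      rw [h0, Ext.mk₀_zero, Ext.zero_comp, Ext.mapExactFunctor_mk₀] at hy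
      have h1 : (restrictQuotient x).map f = 0 :=
        (Ext.mk₀_bijective _ _).1 (by rw [← hy, Ext.mk₀_zero])
      rw [Functor.map_eq_zero_iff] at h1
      rw [h1, Ext.mk₀_zero]
    · intro z
      obtain ⟨y, hy⟩ := Ext.covariant_sequence_exact₁ _ hS z (by
        rw [← Ext.smul_eq_comp_mk₀]
        have : x • z = (Ext.mk₀ (x • 𝟙 ((restrictQuotient x).obj N))).comp z (zero_add _) := by
          rw [Ext.mk₀_smul, Ext.smul_comp, Ext.mk₀_id_comp]
        rw [this, smul_id_restrictQuotient_eq_zero, Ext.mk₀_zero, Ext.zero_comp]) rfl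
      obtain ⟨h, rfl⟩ := (Ext.mk₀_bijective _ _).2 y
      obtain ⟨f, rfl⟩ := (restrictQuotient x).map_surjective h
      exact ⟨Ext.mk₀ f, by rw [extShift_apply, Ext.mapExactFunctor_mk₀, hy]⟩
  | succ n ih =>
    let S := N.projectiveShortComplex
    have hSN : S.ShortExact := N.shortExact_projectiveShortComplex
    have hfree : Module.Free (A ⧸ Ideal.span {x}) S.X₂ := by
      dsimp only [S]; infer_instance
    have hproj : Projective S.X₂ :=
      ModuleCat.projective_of_free (Module.Free.chooseBasis (A ⧸ Ideal.span {x}) S.X₂)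
    have hF := hSN.map_of_exact (restrictQuotient x)
    have hpd : HasProjectiveDimensionLT (S.map (restrictQuotient x)).X₂ 2 :=
      hasProjectiveDimensionLT_restrictQuotient hx S.X₂
    have key : ∀ e, extShift hS S.X₃ (n + 1) (hSN.extClass.comp e (add_comm 1 n)) =
        hF.extClass.comp (extShift hS S.X₁ n e) (by omega) := by
      intro e
      rw [extShift_precomp, Ext.mapExactFunctor_extClass]
      rfl
    change Function.Bijective (extShift hS S.X₃ (n + 1))
    constructor
    · rw [injective_iff_map_eq_zero]
      intro e he
      obtain ⟨e₁, rfl⟩ := Ext.contravariant_sequence_exact₃ hSN _ e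
        (Ext.eq_zero_of_projective _) (add_comm 1 n)
      rw [key] at he
      obtain ⟨y, hy⟩ := Ext.contravariant_sequence_exact₁ hF _ _ _ he
      -- The induction hypothesis for the free cover lifts `y`, so that `e₁` comes from the middle
      -- term and dies under the connecting map.
      obtain ⟨e₂, rfl⟩ := (ih S.X₂).2 y
      have : e₁ = (Ext.mk₀ S.f).comp e₂ (zero_add n) := by
        apply (ih S.X₁).1
        rw [extShift_precomp, Ext.mapExactFunctor_mk₀]
        exact hy.symm
      rw [this, hSN.extClass_comp_assoc]
    · intro z
      obtain ⟨z₁, rfl⟩ := Ext.contravariant_sequence_exact₃ hF _ z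
        (Ext.eq_zero_of_hasProjectiveDimensionLT _ 2 (by omega)) (n₀ := n + 1) (by omega)
      obtain ⟨e₁, rfl⟩ := (ih S.X₁).2 z₁
      exact ⟨_, key e₁⟩

end ChangeOfRings

lemma length_eq_of_bijective {R S M N : Type*} [Ring R] [Ring S] [AddCommGroup M] [AddCommGroup N]
    [Module R M] [Module S N] {σ : R →+* S} (hσ : Function.Surjective σ) (f : M →ₛₗ[σ] N)
    (hf : Function.Bijective f) : Module.length R M = Module.length S N := by
  have : RingHomSurjective σ := ⟨hσ⟩
  rw [Module.length, Module.length, WithBot.unbot_inj,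
    Order.krullDim_eq_of_orderIso (Submodule.orderIsoMapComapOfBijective f hf)]

/-! ### Cohen-Macaulayness and canonical ideals modulo a regular element. -/

section QuotientByRegular

variable {A : Type u} [CommRing A] [IsLocalRing A] {x : A}

lemma isLocalRing_quotient_span_singleton (hxm : x ∈ maximalIdeal A) :
    IsLocalRing (A ⧸ Ideal.span {x}) := by
  have : Nontrivial (A ⧸ Ideal.span {x}) := Ideal.Quotient.nontrivial_iff.mpr fun h ↦ by
    rw [Ideal.span_singleton_eq_top] at h
    exact (mem_maximalIdeal x).mp hxm h
  exact IsLocalRing.of_surjective' (Ideal.Quotient.mk _) Ideal.Quotient.mk_surjective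

variable [IsNoetherianRing A]

/-- An `A`-regular sequence on `M / x M` of length `r` gives one over `A / (x)`. -/
lemma exists_isRegular_quotient {M N : Type u} [AddCommGroup M] [Module A M] [Module.Finite A M]
    [AddCommGroup N] [Module (A ⧸ Ideal.span {x}) N] (hxm : x ∈ maximalIdeal A)
    (reg : IsSMulRegular M x) (f : M →ₛₗ[Ideal.Quotient.mk (Ideal.span {x})] N)
    (hf : Function.Surjective f) (hker : ∀ v, f v = 0 → ∃ w, v = x • w) {r : ℕ}
    (h : ∃ rs : List A, IsRegular M rs ∧ rs.length = r + 1) :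
    ∃ rs : List (A ⧸ Ideal.span {x}), IsRegular N rs ∧ rs.length = r := by
  obtain ⟨rs, hrs, hlen⟩ := exists_isRegular_quotSMulTop hxm reg h
  let F : QuotSMulTop x M →+ N := QuotientAddGroup.lift _ f.toAddMonoidHom (by
    intro v hv
    obtain ⟨w, -, rfl⟩ := (Submodule.mem_smul_pointwise_iff_exists _ _ _).mp hv
    change f (x • w) = 0
    rw [f.map_smulₛₗ, Ideal.Quotient.eq_zero_iff_mem.mpr (Ideal.mem_span_singleton_self x),
      zero_smul])
  have hF : ∀ v : M, F (Submodule.Quotient.mk v) = f v := fun v ↦ rfl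
  have hbij : Function.Bijective F := by
    constructor
    · rw [injective_iff_map_eq_zero]
      intro v hv
      obtain ⟨v, rfl⟩ := Submodule.Quotient.mk_surjective _ v
      obtain ⟨w, rfl⟩ := hker v (by rwa [hF] at hv)
      rw [Submodule.Quotient.mk_eq_zero]
      exact Submodule.smul_mem_pointwise_smul _ _ _ trivial
    · intro n
      obtain ⟨v, rfl⟩ := hf n
      exact ⟨Submodule.Quotient.mk v, rfl⟩
  refine ⟨rs.map (Ideal.Quotient.mk _), ?_, by simpa using hlen⟩
  refine ((AddEquiv.ofBijective F hbij).isRegular_congr (as := rs) ?_).mp hrs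
  rw [List.forall₂_map_right_iff, List.forall₂_same]
  intro a _ v
  obtain ⟨v, rfl⟩ := Submodule.Quotient.mk_surjective _ v
  rw [← Submodule.Quotient.mk_smul]
  exact f.map_smulₛₗ a v

lemma ringKrullDim_quotient_span_singleton (hxm : x ∈ maximalIdeal A) (hx : IsSMulRegular A x)
    {d : ℕ} : ringKrullDim (A ⧸ Ideal.span {x}) = d ↔ ringKrullDim A = (d + 1 : ℕ) := by
  have := ringKrullDim_quotient_span_singleton_succ_eq_ringKrullDim hx hxm
  rw [← this]
  push_cast
  constructor
  · rintro h; rw [h]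
  · intro h
    have h1 := (isLocalRing_quotient_span_singleton hxm).toNontrivial
    obtain ⟨e, he⟩ : ∃ e : ℕ∞, ringKrullDim (A ⧸ Ideal.span {x}) = e :=
      ⟨_, (WithBot.coe_unbot _ (fun h ↦ by
        simpa [h] using ringKrullDim_nonneg_of_nontrivial (R := A ⧸ Ideal.span {x}))).symm⟩
    rw [he] at h ⊢
    norm_cast at h ⊢
    exact (ENat.add_left_injective_of_ne_top ENat.one_ne_top) h

end QuotientByRegular

theorem IsCohenMacaulayLocalRing.quotient {A : Type u} [CommRing A] [IsCohenMacaulayLocalRing A]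
    {x : A} (hxm : x ∈ maximalIdeal A) (hx : IsSMulRegular A x) {d : ℕ}
    (hd : ringKrullDim A = (d + 1 : ℕ)) : IsCohenMacaulayLocalRing (A ⧸ Ideal.span {x}) := by
  have := isLocalRing_quotient_span_singleton hxm
  obtain ⟨rs, hrs, hlen⟩ := IsCohenMacaulayLocalRing.exists_isRegular (A := A)
  rw [hd] at hlen
  have hlen : d + 1 = rs.length := by exact_mod_cast hlen
  obtain ⟨rs', h, h'⟩ := exists_isRegular_quotient (M := A) (N := A ⧸ Ideal.span {x}) hxm hx
    { toFun := Ideal.Quotient.mk _, map_add' := map_add _, map_smul' := map_mul _ }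
    Ideal.Quotient.mk_surjective
    (fun v hv ↦ by
      obtain ⟨w, rfl⟩ := Ideal.mem_span_singleton.mp (Ideal.Quotient.eq_zero_iff_mem.mp hv)
      exact ⟨w, rfl⟩) ⟨rs, hrs, hlen.symm⟩
  exact { exists_isRegular := ⟨rs', h,
    h'.symm ▸ (ringKrullDim_quotient_span_singleton hxm hx).mpr hd⟩ }

-- Regularity of `x` modulo `I` gives `I ∩ (x) = xI`, so the image of `I` is `I/xI`. Its injective
-- dimension and type are then read off from those of `I` through `extShift`.
open Abelian in
theorem IsCanonicalIdeal.map_quotient {A : Type u} [CommRing A] [IsCohenMacaulayLocalRing A]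
    {x : A} (hxm : x ∈ maximalIdeal A) (hx : IsSMulRegular A x) {d : ℕ}
    (hd : ringKrullDim A = (d + 1 : ℕ)) [IsLocalRing (A ⧸ Ideal.span {x})] {I : Ideal A}
    (hI : IsCanonicalIdeal I) (hxI : ∀ c, x * c ∈ I → c ∈ I) :
    IsCanonicalIdeal (I.map (Ideal.Quotient.mk (Ideal.span {x}))) := by
  let f : I →ₛₗ[Ideal.Quotient.mk (Ideal.span {x})] I.map (Ideal.Quotient.mk (Ideal.span {x})) :=
    { toFun i := ⟨Ideal.Quotient.mk _ i, Ideal.mem_map_of_mem _ i.2⟩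
      map_add' i j := by ext; simp
      map_smul' a i := by ext; simp }
  have hf : Function.Surjective f := by
    rintro ⟨b, hb⟩
    obtain ⟨i, hi, rfl⟩ := (Ideal.mem_map_iff_of_surjective _ Ideal.Quotient.mk_surjective).mp hb
    exact ⟨⟨i, hi⟩, rfl⟩
  have hker : ∀ v, f v = 0 → ∃ w, v = x • w := by
    rintro ⟨v, hv⟩ h
    obtain ⟨w, rfl⟩ := Ideal.mem_span_singleton.mp
      (Ideal.Quotient.eq_zero_iff_mem.mp (congrArg Subtype.val h))
    exact ⟨⟨w, hxI w hv⟩, rfl⟩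
  have hreg : IsSMulRegular I x := hx.submodule _ _
  let g : ModuleCat.of A I ⟶ (restrictQuotient x).obj
      (ModuleCat.of (A ⧸ Ideal.span {x}) (I.map (Ideal.Quotient.mk (Ideal.span {x})))) :=
    ModuleCat.ofHom (Y := (restrictQuotient x).obj
      (ModuleCat.of (A ⧸ Ideal.span {x}) (I.map (Ideal.Quotient.mk (Ideal.span {x})))))
      { toFun := f, map_add' := f.map_add, map_smul' := f.map_smulₛₗ }
  have hexact : Function.Exact (x • 𝟙 (ModuleCat.of A I) : ModuleCat.of A I ⟶ _).hom g.hom := by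
    intro v
    constructor
    · intro h
      obtain ⟨w, rfl⟩ := hker v h
      exact ⟨w, rfl⟩
    · rintro ⟨w, rfl⟩
      change f (x • w) = 0
      rw [f.map_smulₛₗ, Ideal.Quotient.eq_zero_iff_mem.mpr (Ideal.mem_span_singleton_self x),
        zero_smul]
  have w : (x • 𝟙 (ModuleCat.of A I)) ≫ g = 0 := by
    exact ModuleCat.hom_ext (LinearMap.ext fun v ↦ hexact.apply_apply_eq_zero v)
  have hS : (ShortComplex.mk (x • 𝟙 (ModuleCat.of A I)) g w).ShortExact :=
    { exact := ModuleCat.shortComplex_exact _ hexact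
      mono_f := (ModuleCat.mono_iff_injective _).mpr hreg
      epi_g := (ModuleCat.epi_iff_surjective _).mpr hf }
  refine ⟨?_, ?_, ?_, ?_, ?_⟩
  · intro h
    have h1 : I.map (Ideal.Quotient.mk (Ideal.span {x})) ≤ maximalIdeal _ := by
      rw [Ideal.map_le_iff_le_comap]
      intro i hi
      have := IsLocalHom.of_surjective (Ideal.Quotient.mk (Ideal.span {x}))
        Ideal.Quotient.mk_surjective
      exact (map_mem_nonunits_iff (Ideal.Quotient.mk (Ideal.span {x})) i).mpr
        (le_maximalIdeal hI.ne_top hi)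
    exact Ideal.IsPrime.ne_top' (top_le_iff.mp (h ▸ h1))
  · exact (Module.Finite.iff_fg).mpr (IsNoetherian.noetherian _)
  · obtain ⟨rs, hrs, hlen⟩ := hI.isCanonicalModule.exists_isRegular
    rw [hd] at hlen
    have hlen : d + 1 = rs.length := by exact_mod_cast hlen
    obtain ⟨rs', h, h'⟩ := exists_isRegular_quotient hxm hreg f hf hker ⟨rs, hrs, hlen.symm⟩
    exact ⟨rs', h, h'.symm ▸ (ringKrullDim_quotient_span_singleton hxm hx).mpr hd⟩
  · obtain ⟨r, hr⟩ := hI.isCanonicalModule.finite_injectiveDimension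
    -- The shift only raises the degree, so the same bound `r` serves.
    refine ⟨r, HasInjectiveDimensionLT.mk fun i hi N e ↦ ?_⟩
    apply (extShift_bijective hx hS N i).1
    rw [map_zero]
    exact Ext.eq_zero_of_hasInjectiveDimensionLT _ (r + 1) (by omega)
  · intro e he
    have h1 := hI.isCanonicalModule.type_eq_one (e + 1)
      ((ringKrullDim_quotient_span_singleton hxm hx).mp he)
    rw [← h1]
    have : IsLocalHom (Ideal.Quotient.mk (Ideal.span {x})) :=
      IsLocalHom.of_surjective _ Ideal.Quotient.mk_surjective
    let φ : ResidueField A →+* ResidueField (A ⧸ Ideal.span {x}) :=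
      ResidueField.map (Ideal.Quotient.mk (Ideal.span {x}))
    have hφ : ∀ a, φ (residue A a) = residue _ (Ideal.Quotient.mk (Ideal.span {x}) a) :=
      fun a ↦ rfl
    let N := (restrictQuotient x).obj
      (ModuleCat.of (A ⧸ Ideal.span {x}) (ResidueField (A ⧸ Ideal.span {x})))
    let φ' : ResidueField A →ₗ[A] N :=
      { toFun := φ
        map_add' := map_add φ
        map_smul' := fun a v ↦ by
          obtain ⟨v, rfl⟩ := residue_surjective v
          exact map_mul φ (residue A a) (residue A v) }
    have hφ' : Function.Bijective φ' := by
      refine ⟨φ.injective, fun v ↦ ?_⟩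
      obtain ⟨b, rfl⟩ := residue_surjective v
      obtain ⟨a, rfl⟩ := Ideal.Quotient.mk_surjective b
      exact ⟨residue A a, rfl⟩
    -- The rings `A` and `A/(x)` have the same residue field, and `Ext` lengths agree over both
    -- since the scalars act through a surjection.
    let ψ : ModuleCat.of A (ResidueField A) ≅ N := (LinearEquiv.ofBijective φ' hφ').toModuleIso
    let E₁ : Ext N (ModuleCat.of A I) (e + 1) ≃ₗ[A]
        Ext (ModuleCat.of A (ResidueField A)) (ModuleCat.of A I) (e + 1) :=
      LinearEquiv.ofLinearMap
        ((Ext.mk₀ ψ.hom).precompOfLinear A (ModuleCat.of A I) (zero_add _))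
        ((Ext.mk₀ ψ.inv).precompOfLinear A (ModuleCat.of A I) (zero_add _))
        (by ext; simp) (by ext; simp)
    rw [← E₁.length_eq]
    let E := AddEquiv.ofBijective _ (extShift_bijective hx hS
      (ModuleCat.of (A ⧸ Ideal.span {x}) (ResidueField (A ⧸ Ideal.span {x}))) e)
    symm
    refine length_eq_of_bijective (σ := Ideal.Quotient.mk (Ideal.span {x}))
      Ideal.Quotient.mk_surjective
      { toFun := E.symm, map_add' := map_add _, map_smul' := fun a v ↦ ?_ } E.symm.bijective
    rw [AddEquiv.symm_apply_eq]
    exact ((extShift_smul hS _ e a (E.symm v)).trans (by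
      rw [show extShift hS _ e (E.symm v) = v from E.apply_symm_apply v])).symm

/-! ### Lengths of localizations at a prime. -/

section LocalLength

variable {R : Type*} [CommRing R]

/-- The length of the localization `M_P` over `R_P`. -/
noncomputable def localLength (P : Ideal R) [P.IsPrime] (M : Type*) [AddCommGroup M] [Module R M] :
    ℕ∞ :=
  Module.length (Localization P.primeCompl) (LocalizedModule P.primeCompl M)

variable (P : Ideal R) [P.IsPrime] {M N L : Type*} [AddCommGroup M] [Module R M]
  [AddCommGroup N] [Module R N] [AddCommGroup L] [Module R L]

lemma localLength_eq_add_of_exact (f : N →ₗ[R] M) (g : M →ₗ[R] L) (hf : Function.Injective f)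
    (hg : Function.Surjective g) (h : Function.Exact f g) :
    localLength P M = localLength P N + localLength P L :=
  Module.length_eq_add_of_exact (LocalizedModule.map P.primeCompl f)
    (LocalizedModule.map P.primeCompl g)
    (IsLocalizedModule.map_injective P.primeCompl _ _ f hf)
    (IsLocalizedModule.map_surjective P.primeCompl _ _ g hg)
    (LocalizedModule.map_exact P.primeCompl f g h)

lemma localLength_eq_zero (h : ∀ v : M, ∃ s ∉ P, s • v = 0) : localLength P M = 0 := by
  have : Subsingleton (LocalizedModule P.primeCompl M) :=
    LocalizedModule.subsingleton_iff.mpr h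
  exact Module.length_eq_zero

lemma localLength_of_subsingleton [Subsingleton M] : localLength P M = 0 :=
  localLength_eq_zero P fun _ ↦ ⟨1, P.primeCompl.one_mem, Subsingleton.elim _ _⟩

lemma localLength_congr (e : M ≃ₗ[R] N) : localLength P M = localLength P N := by
  have := localLength_eq_add_of_exact P e.toLinearMap (0 : N →ₗ[R] PUnit) e.injective
    (Function.surjective_to_subsingleton _) (by
      intro m; simp)
  rw [localLength_of_subsingleton P (M := PUnit), add_zero] at this
  exact this.symm

lemma localLength_eq_range_add_range (f : N →ₗ[R] M) (g : M →ₗ[R] L) (h : Function.Exact f g) :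
    localLength P M = localLength P (LinearMap.range f) + localLength P (LinearMap.range g) :=
  localLength_eq_add_of_exact P (LinearMap.range f).subtype g.rangeRestrict
    (Submodule.subtype_injective _) g.surjective_rangeRestrict (by
      intro m
      have := h m
      simp only [Submodule.subtype_apply, Set.mem_range, Subtype.exists, exists_prop,
        exists_eq_right, LinearMap.mem_range, Subtype.ext_iff, LinearMap.codRestrict_apply] at this ⊢
      exact this)

lemma localLength_range_of_injective (f : N →ₗ[R] M) (hf : Function.Injective f) :
    localLength P (LinearMap.range f) = localLength P N :=
  (localLength_congr P (LinearEquiv.ofInjective f hf)).symm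

lemma localLength_range_of_surjective (f : N →ₗ[R] M) (hf : Function.Surjective f) :
    localLength P (LinearMap.range f) = localLength P M :=
  localLength_congr P ((LinearEquiv.ofEq _ _ (LinearMap.range_eq_top.mpr hf)).trans
    Submodule.topEquiv)

lemma localLength_quotient_self : localLength P (R ⧸ P) = 1 := by
  rw [localLength, Module.length_eq_one_iff, isSimpleModule_iff_toSpanSingleton_surjective]
  constructor
  · rw [← not_subsingleton_iff_nontrivial, LocalizedModule.subsingleton_iff]
    push Not
    refine ⟨Ideal.Quotient.mk P 1, fun r hr h ↦ hr ?_⟩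
    rw [← Ideal.Quotient.mk_eq_mk, ← Submodule.Quotient.mk_smul, Ideal.Quotient.mk_eq_mk,
      Ideal.Quotient.eq_zero_iff_mem, smul_eq_mul, mul_one] at h
    exact h
  · intro v hv w
    induction v with | _ m s
    induction w with | _ m' s'
    obtain ⟨r, rfl⟩ := Ideal.Quotient.mk_surjective m
    obtain ⟨r', rfl⟩ := Ideal.Quotient.mk_surjective m'
    have hr : r ∈ P.primeCompl := by
      intro hr
      apply hv
      rw [Ideal.Quotient.eq_zero_iff_mem.mpr hr, LocalizedModule.zero_mk]
    refine ⟨Localization.mk (r' * s) (⟨r, hr⟩ * s'), ?_⟩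
    rw [LinearMap.toSpanSingleton_apply, LocalizedModule.mk_smul_mk, LocalizedModule.mk_eq]
    refine ⟨1, ?_⟩
    simp only [Submonoid.smul_def, Submonoid.coe_mul, one_smul, ← Ideal.Quotient.mk_eq_mk,
      ← Submodule.Quotient.mk_smul, smul_eq_mul]
    congr 1
    ring

/-- The length of a localization does not change under restriction of scalars along a surjective
ring homomorphism. -/
lemma localLength_comap {R' M' : Type*} [CommRing R'] [AddCommGroup M'] [Module R' M']
    {φ : R →+* R'} (hφ : Function.Surjective φ) {P : Ideal R} [P.IsPrime] {P' : Ideal R'}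
    [P'.IsPrime] (hP : P = P'.comap φ) (f : M →ₛₗ[φ] M') (hf : Function.Bijective f) :
    localLength P M = localLength P' M' := by
  have mem : ∀ s : P.primeCompl, φ s ∈ P'.primeCompl := fun s h ↦ s.2 (hP.ge h)
  let F : LocalizedModule P.primeCompl M → LocalizedModule P'.primeCompl M' := fun v ↦
    v.liftOn (fun p ↦ LocalizedModule.mk (f p.1) ⟨φ p.2, mem p.2⟩) (by
      rintro ⟨m, s⟩ ⟨m', s'⟩ ⟨u, hu⟩
      rw [LocalizedModule.mk_eq]
      refine ⟨⟨φ u, mem u⟩, ?_⟩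
      have := congrArg f hu
      simpa only [Submonoid.smul_def, f.map_smulₛₗ] using this)
  have hF : ∀ m s, F (LocalizedModule.mk m s) = LocalizedModule.mk (f m) ⟨φ s, mem s⟩ :=
    fun m s ↦ LocalizedModule.liftOn_mk _ _ _
  let F' : LocalizedModule P.primeCompl M →ₛₗ[Localization.localRingHom P P' φ hP]
      LocalizedModule P'.primeCompl M' :=
    { toFun := F
      map_add' := fun v w ↦ by
        induction v with | _ m s
        induction w with | _ m' s'
        rw [LocalizedModule.mk_add_mk, hF, hF, hF, LocalizedModule.mk_add_mk]
        congr 1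
        · simp only [Submonoid.smul_def, map_add, f.map_smulₛₗ]
        · ext; simp
      map_smul' := fun a v ↦ by
        induction v with | _ m s
        induction a using Localization.induction_on with | _ p
        rw [LocalizedModule.mk_smul_mk, hF, hF, Localization.localRingHom_mk]
        erw [LocalizedModule.mk_smul_mk]
        congr 1
        · rw [f.map_smulₛₗ]
        · ext; simp }
  refine length_eq_of_bijective (σ := Localization.localRingHom P P' φ hP) ?_ F' ⟨?_, ?_⟩
  · intro b
    induction b using Localization.induction_on with | _ p
    obtain ⟨r, hr⟩ := hφ p.1
    obtain ⟨s, hs⟩ := hφ p.2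
    have hsP : s ∈ P.primeCompl := fun h ↦ p.2.2 (hs ▸ hP.le h)
    refine ⟨Localization.mk r ⟨s, hsP⟩, ?_⟩
    rw [Localization.localRingHom_mk]
    congr 1
    ext; exact hs
  · rw [injective_iff_map_eq_zero]
    intro v hv
    induction v with | _ m s
    replace hv : F (LocalizedModule.mk m s) = 0 := hv
    rw [hF, ← LocalizedModule.zero_mk 1, LocalizedModule.mk_eq] at hv
    obtain ⟨⟨u, hu⟩, h⟩ := hv
    obtain ⟨u, rfl⟩ := hφ u
    have huP : u ∈ P.primeCompl := fun h ↦ hu (hP.le h)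
    simp only [Submonoid.smul_def, smul_zero, one_smul] at h
    rw [← f.map_smulₛₗ, ← map_zero f] at h
    rw [← LocalizedModule.zero_mk 1, LocalizedModule.mk_eq]
    refine ⟨⟨u, huP⟩, ?_⟩
    simpa only [Submonoid.smul_def, smul_zero, Submonoid.coe_one, one_smul] using hf.1 h
  · intro w
    induction w with | _ m' s'
    obtain ⟨m, rfl⟩ := hf.2 m'
    obtain ⟨s, hs⟩ := hφ s'
    have hsP : s ∈ P.primeCompl := fun h ↦ s'.2 (hs ▸ hP.le h)
    refine ⟨LocalizedModule.mk m ⟨s, hsP⟩, (hF _ _).trans ?_⟩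
    congr 1
    ext; exact hs

end LocalLength

/-! ### Kernel and cokernel of a multiplication in short exact sequences. -/

section Herbrand

variable {R : Type*} [CommRing R] (P : Ideal R) [P.IsPrime] (y : R)

/-- The kernel of the multiplication by `y` on a module. -/
abbrev smulKer (M : Type*) [AddCommGroup M] [Module R M] : Submodule R M :=
  LinearMap.ker (LinearMap.lsmul R M y)

/-- The cokernel of the multiplication by `y` on a module. -/
abbrev SMulCoker (M : Type*) [AddCommGroup M] [Module R M] : Type _ :=
  M ⧸ LinearMap.range (LinearMap.lsmul R M y)

variable {N M L : Type*} [AddCommGroup M] [Module R M]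
  [AddCommGroup N] [Module R N] [AddCommGroup L] [Module R L]

/-- The two lengths in the Herbrand quotient of the multiplication by `y` are additive up to a
common correction term. -/
lemma exists_localLength_smulKer_add (f : N →ₗ[R] M) (g : M →ₗ[R] L) (hf : Function.Injective f)
    (hg : Function.Surjective g) (h : Function.Exact f g) :
    ∃ i₂ i₃ i₄ : ℕ∞, localLength P (smulKer y M) = localLength P (smulKer y N) + i₂ ∧
      localLength P (smulKer y L) = i₂ + i₃ ∧ localLength P (SMulCoker y N) = i₃ + i₄ ∧
      localLength P (SMulCoker y M) = i₄ + localLength P (SMulCoker y L) := by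
  let K₁ : smulKer y N →ₗ[R] smulKer y M := f.restrict (by
    intro n hn
    have : y • n = 0 := hn
    simp [← map_smul, this])
  let K₂ : smulKer y M →ₗ[R] smulKer y L := g.restrict (by
    intro n hn
    have : y • n = 0 := hn
    simp [← map_smul, this])
  let C₁ : SMulCoker y N →ₗ[R] SMulCoker y M := Submodule.mapQ _ _ f (by
    rintro _ ⟨n, rfl⟩
    exact ⟨f n, by simp⟩)
  let C₂ : SMulCoker y M →ₗ[R] SMulCoker y L := Submodule.mapQ _ _ g (by
    rintro _ ⟨n, rfl⟩
    exact ⟨g n, by simp⟩)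
  have hK₁ : Function.Injective K₁ := fun a b hab ↦ Subtype.ext (hf (congrArg Subtype.val hab))
  have hC₂ : Function.Surjective C₂ := by
    intro l
    obtain ⟨l, rfl⟩ := Submodule.Quotient.mk_surjective _ l
    obtain ⟨m, rfl⟩ := hg l
    exact ⟨Submodule.Quotient.mk m, rfl⟩
  have hK : Function.Exact K₁ K₂ := by
    rintro ⟨m, hm⟩
    rw [Subtype.ext_iff]
    refine (h m).trans ?_
    constructor
    · rintro ⟨n, rfl⟩
      refine ⟨⟨n, hf ?_⟩, rfl⟩
      have : y • f n = 0 := hm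
      simpa using this
    · rintro ⟨n, hn⟩
      exact ⟨n, congrArg Subtype.val hn⟩
  have hC : Function.Exact C₁ C₂ := by
    intro m
    obtain ⟨m, rfl⟩ := Submodule.Quotient.mk_surjective _ m
    constructor
    · intro hm
      obtain ⟨l, hl⟩ := (Submodule.Quotient.mk_eq_zero _).mp
        (show (Submodule.Quotient.mk (g m) : SMulCoker y L) = 0 from hm)
      obtain ⟨m', rfl⟩ := hg l
      obtain ⟨n, hn⟩ := (h (m - y • m')).mp (by
        rw [map_sub, map_smul, sub_eq_zero]; exact hl.symm)
      refine ⟨Submodule.Quotient.mk n, ?_⟩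
      refine (Submodule.Quotient.eq _).mpr ⟨-m', ?_⟩
      simp [hn]
    · rintro ⟨n, hn⟩
      obtain ⟨n, rfl⟩ := Submodule.Quotient.mk_surjective _ n
      rw [← hn]
      change (Submodule.Quotient.mk (g (f n)) : SMulCoker y L) = 0
      rw [h.apply_apply_eq_zero, Submodule.Quotient.mk_zero]
  have comm₁ : f ∘ₗ LinearMap.lsmul R N y = LinearMap.lsmul R M y ∘ₗ f := by ext; simp
  have comm₂ : g ∘ₗ LinearMap.lsmul R M y = LinearMap.lsmul R L y ∘ₗ g := by ext; simp
  have hπN : Function.Exact (LinearMap.lsmul R N y) (LinearMap.range (LinearMap.lsmul R N y)).mkQ :=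
    LinearMap.exact_map_mkQ_range _
  have hπM : Function.Exact (LinearMap.lsmul R M y) (LinearMap.range (LinearMap.lsmul R M y)).mkQ :=
    LinearMap.exact_map_mkQ_range _
  have hιM : Function.Exact (smulKer y M).subtype (LinearMap.lsmul R M y) :=
    LinearMap.exact_subtype_ker_map _
  have hιL : Function.Exact (smulKer y L).subtype (LinearMap.lsmul R L y) :=
    LinearMap.exact_subtype_ker_map _
  let δ := SnakeLemma.δ' _ _ _ f g h f g h comm₁ comm₂ _ hιL _ hπN hg hf
  have hδ₁ : Function.Exact K₂ δ := SnakeLemma.exact_δ'_right _ _ _ f g h f g h comm₁ comm₂ _ hιM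
    _ hιL _ hπN hg hf K₂ rfl (Submodule.subtype_injective _)
  have hδ₂ : Function.Exact δ C₁ := SnakeLemma.exact_δ'_left _ _ _ f g h f g h comm₁ comm₂
    _ hιL _ hπN _ hπM hg hf C₁ rfl (Submodule.mkQ_surjective _)
  -- The correction terms are the images of the three inner maps of the six-term snake sequence.
  -- Lengths may be infinite, hence sums rather than differences.
  refine ⟨localLength P (LinearMap.range K₂), localLength P (LinearMap.range δ),
    localLength P (LinearMap.range C₁), ?_, ?_, ?_, ?_⟩
  · rw [localLength_eq_range_add_range P _ _ hK, localLength_range_of_injective P _ hK₁]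
  · exact localLength_eq_range_add_range P _ _ hδ₁
  · exact localLength_eq_range_add_range P _ _ hδ₂
  · rw [localLength_eq_range_add_range P _ _ hC, localLength_range_of_surjective P _ hC₂]

end Herbrand

/-! ### The associativity formula for one element. -/

section Associativity

variable {R : Type*} [CommRing R] [IsNoetherianRing R] {p q : Ideal R} [p.IsPrime] [q.IsPrime]
  {y : R}

/-- A case of the principal ideal theorem. If `y ∉ P`, then `a = b + cy ∈ P` with `b ∈ p` forces `c
∈ P`, so `P = yP + p`. Nakayama gives `r ≡ 1` modulo `y` with `rP ⊆ p`; as `P ≠ p`, this puts `r` in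
`p` and `1` in `q`. -/
lemma eq_of_lt_of_le_sup_span (hq : q = p ⊔ Ideal.span {y}) {P : Ideal R} [P.IsPrime]
    (hpP : p < P) (hPq : P ≤ q) : P = q := by
  refine le_antisymm hPq ?_
  rw [hq, sup_le_iff, Ideal.span_singleton_le_iff_mem]
  refine ⟨hpP.le, ?_⟩
  by_contra hyP
  have key : P ≤ Ideal.span {y} * P ⊔ p := by
    intro a ha
    obtain ⟨b, hb, c, hc, rfl⟩ := Submodule.mem_sup.mp (hq ▸ hPq ha)
    obtain ⟨c, rfl⟩ := Ideal.mem_span_singleton'.mp hc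
    have hcP : c ∈ P := by
      refine (Ideal.IsPrime.mem_or_mem ‹P.IsPrime› ?_).resolve_right hyP
      simpa using Ideal.sub_mem _ ha (hpP.le hb)
    have hcy : c * y ∈ Ideal.span {y} * P :=
      mul_comm c y ▸ Ideal.mul_mem_mul (Ideal.mem_span_singleton_self y) hcP
    rw [add_comm]
    exact Submodule.add_mem_sup hcy hb
  obtain ⟨r, hr, hrP⟩ := Submodule.exists_sub_one_mem_and_smul_eq_zero_of_fg_of_le_smul
    (Ideal.span {y}) (Submodule.map (Submodule.mkQ p) P) ((IsNoetherian.noetherian P).map _) (by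
      refine (Submodule.map_mono key).trans ?_
      rw [Submodule.map_sup, ← smul_eq_mul, Submodule.map_smul'', sup_le_iff]
      refine ⟨le_rfl, ?_⟩
      rintro _ ⟨b, hb, rfl⟩
      rw [Submodule.mkQ_apply, (Submodule.Quotient.mk_eq_zero p).mpr hb]
      exact Submodule.zero_mem _)
  obtain ⟨n, hnP, hnp⟩ := SetLike.exists_of_lt hpP
  have h1 : r * n ∈ p := by
    have := hrP (Submodule.mkQ p n) (Submodule.mem_map_of_mem hnP)
    rwa [← map_smul, Submodule.mkQ_apply, Submodule.Quotient.mk_eq_zero] at this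
  have h2 : r ∈ p := (Ideal.IsPrime.mem_or_mem ‹p.IsPrime› h1).resolve_right hnp
  apply Ideal.IsPrime.ne_top ‹q.IsPrime›
  rw [Ideal.eq_top_iff_one, hq]
  have := Submodule.add_mem_sup h2 (neg_mem hr)
  simpa using this

/-- The associativity formula for a principal ideal in a one-dimensional situation: the localized
Herbrand quotient of `y` on a module supported at `p` is the multiplicity of the module at `p`. -/
theorem localLength_smulCoker (hyp : y ∉ p) (hq : q = p ⊔ Ideal.span {y}) {M : Type*}
    [AddCommGroup M] [Module R M] [Module.Finite R M] {k : ℕ} (hk : ∀ a ∈ p ^ k, ∀ v : M, a • v = 0) :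
    localLength q (SMulCoker y M) = localLength p M + localLength q (smulKer y M) := by
  revert hk
  induction ‹Module.Finite R M› using
    IsNoetherianRing.induction_on_isQuotientEquivQuotientPrime R with
  | subsingleton N =>
    intro _
    rw [localLength_of_subsingleton, localLength_of_subsingleton, localLength_of_subsingleton,
      add_zero]
  | quotient N P e =>
    intro hk
    have hpP : p ≤ P.1 := by
      have : p ^ k ≤ P.1 := fun a ha ↦ by
        have h1 : a • Ideal.Quotient.mk P.1 1 = 0 := by
          rw [← e.apply_symm_apply (Ideal.Quotient.mk P.1 1), ← map_smul, hk a ha, map_zero]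
        rw [← Ideal.Quotient.mk_eq_mk, ← Submodule.Quotient.mk_smul, Ideal.Quotient.mk_eq_mk,
          Ideal.Quotient.eq_zero_iff_mem, smul_eq_mul, mul_one] at h1
        exact h1
      exact Ideal.IsPrime.le_of_pow_le this
    have hann : ∀ a ∈ P.1, ∀ v : N, a • v = 0 := by
      intro a ha v
      apply e.injective
      obtain ⟨b, hb⟩ := Ideal.Quotient.mk_surjective (e v)
      rw [map_smul, map_zero, ← hb, ← Ideal.Quotient.mk_eq_mk, ← Submodule.Quotient.mk_smul,
        Ideal.Quotient.mk_eq_mk, Ideal.Quotient.eq_zero_iff_mem]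
      exact P.1.mul_mem_right _ ha
    -- By dévissage `N = R/P` with `P ⊇ p`. If `P ⊄ q`, all three localizations vanish. If `P = p`,
    -- then `y` is injective with cokernel `R/q`, giving `1 = 1 + 0`. Otherwise `P = q`, so `y` acts
    -- as zero, kernel and cokernel are both `N`, and `N_p = 0`.
    by_cases hPq : P.1 ≤ q
    swap
    · obtain ⟨s, hs, hsq⟩ := SetLike.not_le_iff_exists.mp hPq
      have hsp : s ∉ p := fun h ↦ hsq (hq ▸ Ideal.mem_sup_left h)
      rw [localLength_eq_zero p fun v ↦ ⟨s, hsp, hann s hs v⟩,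
        localLength_eq_zero q fun v ↦ ⟨s, hsq, Subtype.ext (hann s hs v)⟩,
        localLength_eq_zero q fun v ↦ ⟨s, hsq, ?_⟩, add_zero]
      obtain ⟨v, rfl⟩ := Submodule.Quotient.mk_surjective _ v
      rw [← Submodule.Quotient.mk_smul, hann s hs, Submodule.Quotient.mk_zero]
    rcases hpP.eq_or_lt with hpP | hpP
    · have hker : Subsingleton (smulKer y N) := by
        refine (Submodule.subsingleton_iff_eq_bot).mpr (LinearMap.ker_eq_bot'.mpr fun v hv ↦ ?_)
        apply e.injective
        obtain ⟨b, hb⟩ := Ideal.Quotient.mk_surjective (e v)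
        have h1 : e (y • v) = 0 := by rw [← map_zero e]; exact congrArg e hv
        rw [map_smul, ← hb, ← Ideal.Quotient.mk_eq_mk, ← Submodule.Quotient.mk_smul,
          Ideal.Quotient.mk_eq_mk, Ideal.Quotient.eq_zero_iff_mem, smul_eq_mul] at h1
        rw [map_zero, ← hb, Ideal.Quotient.eq_zero_iff_mem]
        exact (P.2.mem_or_mem h1).resolve_left (hpP ▸ hyp)
      have e' : N ≃ₗ[R] R ⧸ p := e.trans (Submodule.quotEquivOfEq _ _ hpP.symm)
      have hp1 : localLength p N = 1 := (localLength_congr p e').trans (localLength_quotient_self p)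
      have hpq : p ≤ q := hpP ▸ hPq
      let g : N →ₗ[R] R ⧸ q := (Submodule.factor hpq).comp e'.toLinearMap
      have hg : Function.Surjective g := (Submodule.factor_surjective hpq).comp e'.surjective
      have hgker : LinearMap.ker g = LinearMap.range (LinearMap.lsmul R N y) := by
        ext v
        obtain ⟨b, hb⟩ := Submodule.Quotient.mk_surjective _ (e' v)
        have h1 : g v = Submodule.Quotient.mk b := by
          change Submodule.factor hpq (e' v) = _
          rw [← hb]; rfl
        rw [LinearMap.mem_ker, h1, Submodule.Quotient.mk_eq_zero, hq]
        constructor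
        · intro h
          obtain ⟨c, hc, t, ht, rfl⟩ := Submodule.mem_sup.mp h
          obtain ⟨t, rfl⟩ := Ideal.mem_span_singleton.mp ht
          refine ⟨e'.symm (Submodule.Quotient.mk t), ?_⟩
          apply e'.injective
          rw [LinearMap.lsmul_apply, map_smul, e'.apply_symm_apply, ← hb,
            ← Submodule.Quotient.mk_smul, smul_eq_mul, Submodule.Quotient.mk_add,
            (Submodule.Quotient.mk_eq_zero p).mpr hc, zero_add]
        · rintro ⟨w, rfl⟩
          obtain ⟨c, hc⟩ := Submodule.Quotient.mk_surjective _ (e' w)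
          rw [LinearMap.lsmul_apply, map_smul, ← hc, ← Submodule.Quotient.mk_smul,
            Submodule.Quotient.eq] at hb
          have := Submodule.add_mem_sup hb (Ideal.mem_span_singleton'.mpr ⟨c, rfl⟩ : c * y ∈ Ideal.span {y})
          convert this using 1
          simp only [smul_eq_mul]
          ring
      rw [hp1, localLength_of_subsingleton q (M := smulKer y N), add_zero,
        localLength_congr q ((Submodule.quotEquivOfEq _ _ hgker.symm).trans
          (LinearMap.quotKerEquivOfSurjective g hg)), localLength_quotient_self]
    · have hP : P.1 = q := by
        have := P.2
        exact eq_of_lt_of_le_sup_span hq hpP hPq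
      have hyP : y ∈ P.1 := hP ▸ hq ▸ Ideal.mem_sup_right (Ideal.mem_span_singleton_self y)
      have h0 : LinearMap.lsmul R N y = 0 := by
        ext v; exact hann y hyP v
      have e₁ : smulKer y N ≃ₗ[R] N :=
        (LinearEquiv.ofEq _ _ (by rw [smulKer, h0, LinearMap.ker_zero])).trans Submodule.topEquiv
      have e₂ : SMulCoker y N ≃ₗ[R] N :=
        (Submodule.quotEquivOfEqBot _ (by rw [h0, LinearMap.range_zero]))
      rw [localLength_congr q e₁, localLength_congr q e₂,
        localLength_eq_zero p fun v ↦ ⟨y, hyp, hann y hyP v⟩, zero_add]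
  | exact N₁ N₂ N₃ f g hf hg hfg ih₁ ih₃ =>
    intro hk
    have h₁ := ih₁ fun a ha v ↦ hf (by rw [map_smul, hk a ha, map_zero])
    have h₃ := ih₃ fun a ha v ↦ by
      obtain ⟨v, rfl⟩ := hg v
      rw [← map_smul, hk a ha, map_zero]
    obtain ⟨i₂, i₃, i₄, hK, hL, hC, hM⟩ := exists_localLength_smulKer_add q y f g hf hg hfg
    rw [hM, hK, h₃, hL, localLength_eq_add_of_exact p f g hf hg hfg]
    rw [hC] at h₁
    calc i₄ + (localLength p N₃ + (i₂ + i₃)) = (i₃ + i₄) + (localLength p N₃ + i₂) := by ring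
      _ = _ := by rw [h₁]; ring

end Associativity

/-! ### Building and lifting polynomials coefficientwise. -/

section Polynomials

variable {A B : Type*} [CommRing A] [CommRing B]

lemma exists_polynomial_of_coeff {P : ℕ → A → Prop} (h : ∀ i, ∃ c, P i c) {N : ℕ}
    (hN : ∀ i, N ≤ i → P i 0) : ∃ g : A[X], ∀ i, P i (g.coeff i) := by
  choose c hc using h
  refine ⟨∑ i ∈ Finset.range N, monomial i (c i), fun i ↦ ?_⟩
  rw [finsetSum_coeff]
  simp only [coeff_monomial, Finset.sum_ite_eq', Finset.mem_range]
  split_ifs with h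
  · exact hc i
  · exact hN i (not_lt.mp h)

lemma exists_polynomial_lift {f : A →+* B} (hf : Function.Surjective f) {K : ℕ → Ideal A} {g : B[X]}
    (hg : ∀ i, g.coeff i ∈ (K i).map f) : ∃ h : A[X], h.map f = g ∧ ∀ i, h.coeff i ∈ K i := by
  obtain ⟨h, hh⟩ := exists_polynomial_of_coeff
    (P := fun i c ↦ c ∈ K i ∧ f c = g.coeff i) (fun i ↦
      (Ideal.mem_map_iff_of_surjective f hf).mp (hg i)) (N := g.natDegree + 1) (fun i hi ↦
      ⟨zero_mem _, by rw [map_zero, coeff_eq_zero_of_natDegree_lt (by omega)]⟩)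
  exact ⟨h, by ext i; rw [coeff_map, (hh i).2], fun i ↦ (hh i).1⟩

lemma mem_of_monomial_mem {R : Type*} [Semiring R] [Module R A[X]] {N : Submodule R A[X]} {f : A[X]}
    (h : ∀ i, monomial i (f.coeff i) ∈ N) : f ∈ N := by
  rw [f.as_sum_support]
  exact sum_mem fun i _ ↦ h i

end Polynomials

/-! ### Rees algebras described by coefficients. -/

section Rees

variable {A : Type u} [CommRing A] (Q : Ideal A)

lemma algebraMap_rees_injective : Function.Injective (algebraMap (Rees Q) A[X]) :=
  Subtype.val_injective

variable {Q}

lemma coeff_algebraMap_rees (f : Rees Q) (i : ℕ) : (algebraMap (Rees Q) A[X] f).coeff i ∈ Q ^ i :=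
  (mem_reesAlgebra_iff Q _).mp f.2 i

/-- The element of the Rees algebra with prescribed underlying polynomial. -/
noncomputable def reesMk (f : A[X]) (hf : ∀ i, f.coeff i ∈ Q ^ i) : Rees Q :=
  (⟨f, (mem_reesAlgebra_iff Q f).mpr hf⟩ : reesAlgebra Q)

@[simp]
lemma algebraMap_reesMk (f : A[X]) (hf : ∀ i, f.coeff i ∈ Q ^ i) :
    algebraMap (Rees Q) A[X] (reesMk f hf) = f := rfl

@[simp]
lemma algebraMap_degreeOne (x : Q) :
    algebraMap (Rees Q) A[X] (degreeOne Q x) = monomial 1 (x : A) := rfl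

@[simp]
lemma algebraMap_algebraMap_rees (c : A) :
    algebraMap (Rees Q) A[X] (algebraMap A (Rees Q) c) = C c := rfl

lemma coeff_monomial_mem {i : ℕ} {c : A} (hc : c ∈ Q ^ i) (k : ℕ) :
    (monomial i c).coeff k ∈ Q ^ k := by
  rw [coeff_monomial]
  split_ifs with h
  · exact h ▸ hc
  · exact zero_mem _

lemma coeff_monomial_one_mul_succ (x : A) (f : A[X]) (i : ℕ) :
    (monomial 1 x * f).coeff (i + 1) = x * f.coeff i := by
  rw [coeff_monomial_mul]

lemma coeff_monomial_one_mul_zero (x : A) (f : A[X]) : (monomial 1 x * f).coeff 0 = 0 := by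
  rw [← C_mul_X_eq_monomial, mul_assoc, coeff_C_mul, coeff_X_mul_zero, mul_zero]

/-- For `Q ≤ Q'`, the module `J A[Q't]` consists of the polynomials with coefficients in
`J Q' ^ i`. -/
theorem mem_idealMul_iff {Q Q' J : Ideal A} (h : Q ≤ Q') {f : A[X]} :
    f ∈ idealMul Q J (reesAlgebra Q') ↔ ∀ i, f.coeff i ∈ J * Q' ^ i := by
  constructor
  · intro hf
    induction hf using Submodule.span_induction with
    | mem f hf =>
      obtain ⟨c, hc, g, hg, rfl⟩ := hf
      intro i
      rw [coeff_C_mul]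
      exact Ideal.mul_mem_mul hc ((mem_reesAlgebra_iff Q' g).mp hg i)
    | zero => simp
    | add f g _ _ hf hg => exact fun i ↦ by rw [coeff_add]; exact add_mem (hf i) (hg i)
    | smul r f _ hf =>
      intro i
      rw [Algebra.smul_def, coeff_mul]
      refine sum_mem fun jk hjk ↦ ?_
      rw [← Finset.HasAntidiagonal.mem_antidiagonal.mp hjk, pow_add, mul_left_comm]
      exact Ideal.mul_mem_mul (Ideal.pow_right_mono h _ (coeff_algebraMap_rees r _)) (hf _)
  · intro hf
    refine mem_of_monomial_mem fun i ↦ ?_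
    have hfi := hf i
    generalize f.coeff i = c at hfi
    induction hfi using Submodule.mul_induction_on' with
    | mem_mul_mem c hc b hb =>
      refine Submodule.subset_span ⟨c, hc, monomial i b, ?_, by rw [C_mul_monomial]⟩
      exact (mem_reesAlgebra_iff Q' _).mpr (coeff_monomial_mem hb)
    | add b _ c _ hb hc => rw [map_add]; exact add_mem hb hc

lemma mem_map_algebraMap_rees_iff {J : Ideal A} {f : Rees Q} :
    f ∈ J.map (algebraMap A (Rees Q)) ↔
      ∀ i, (algebraMap (Rees Q) A[X] f).coeff i ∈ J * Q ^ i := by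
  rw [← mem_idealMul_iff le_rfl]
  constructor
  · intro hf
    suffices J.map (algebraMap A (Rees Q)) ≤
        (idealMul Q J (reesAlgebra Q)).comap (Algebra.linearMap (Rees Q) A[X]) from this hf
    refine Ideal.map_le_iff_le_comap.mpr fun c hc ↦ Submodule.subset_span ⟨c, hc, 1, one_mem _, ?_⟩
    rw [mul_one]
    rfl
  · intro hf
    have : idealMul Q J (reesAlgebra Q) ≤
        Submodule.map (Algebra.linearMap (Rees Q) A[X]) (J.map (algebraMap A (Rees Q))) := by
      refine Submodule.span_le.mpr ?_
      rintro _ ⟨c, hc, g, hg, rfl⟩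
      refine ⟨algebraMap A (Rees Q) c * reesMk g ((mem_reesAlgebra_iff Q g).mp hg),
        Ideal.mul_mem_right _ _ (Ideal.mem_map_of_mem _ hc), ?_⟩
      rfl
    obtain ⟨g, hg, hgf⟩ := this hf
    rwa [← algebraMap_rees_injective Q hgf]

lemma mem_maxExtension_iff [IsLocalRing A] {f : Rees Q} :
    f ∈ maxExtension Q ↔ ∀ i, (algebraMap (Rees Q) A[X] f).coeff i ∈ maximalIdeal A * Q ^ i :=
  mem_map_algebraMap_rees_iff

instance [IsNoetherianRing A] : IsNoetherianRing (Rees Q) :=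
  inferInstanceAs (IsNoetherianRing (reesAlgebra Q))

/-- The map of Rees algebras induced by a ring homomorphism. -/
noncomputable def reesMap {B : Type u} [CommRing B] (φ : A →+* B) (Q : Ideal A) :
    Rees Q →+* Rees (Q.map φ) :=
  RingHom.codRestrict ((mapRingHom φ).comp (algebraMap (Rees Q) A[X])) (reesAlgebra (Q.map φ))
    fun f ↦ (mem_reesAlgebra_iff _ _).mpr fun i ↦ by
      rw [RingHom.comp_apply, coe_mapRingHom, coeff_map, ← Ideal.map_pow]
      exact Ideal.mem_map_of_mem _ (coeff_algebraMap_rees f i)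

variable {B : Type u} [CommRing B] {φ : A →+* B}

@[simp]
lemma algebraMap_reesMap (f : Rees Q) :
    algebraMap (Rees (Q.map φ)) B[X] (reesMap φ Q f) = (algebraMap (Rees Q) A[X] f).map φ := rfl

lemma reesMap_surjective (hφ : Function.Surjective φ) : Function.Surjective (reesMap φ Q) := by
  intro g
  obtain ⟨f, hf, hfQ⟩ := exists_polynomial_lift hφ (K := (Q ^ ·))
    (g := algebraMap (Rees (Q.map φ)) B[X] g) fun i ↦ by
      rw [Ideal.map_pow]; exact coeff_algebraMap_rees g i
  exact ⟨reesMk f hfQ, algebraMap_rees_injective _ (by simp [hf])⟩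

lemma reesMap_degreeOne_eq_zero {x : Q} (hx : φ x = 0) : reesMap φ Q (degreeOne Q x) = 0 :=
  algebraMap_rees_injective _ (by simp [hx])

lemma reesMap_algebraMap (c : A) :
    reesMap φ Q (algebraMap A (Rees Q) c) = algebraMap B (Rees (Q.map φ)) (φ c) :=
  algebraMap_rees_injective _ (by simp)

end Rees

/-! ### Primality of `𝔪R(Q)`. -/

section Prime

/-- By separatedness each `f ∉ p` equals `y^n g` modulo `p` with `g ∉ p + (y)`. A product of two
such `g` avoids `p + (y)`, and powers of `y` cancel modulo `p`. -/
lemma isPrime_of_isPrime_sup_span {R : Type*} [CommRing R] {p : Ideal R} {y : R}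
    (hreg : ∀ f, y * f ∈ p → f ∈ p) (hsep : ∀ f, (∀ n : ℕ, f ∈ p ⊔ Ideal.span {y ^ n}) → f ∈ p)
    (h : (p ⊔ Ideal.span {y}).IsPrime) : p.IsPrime := by
  classical
  have hreg' : ∀ n f, y ^ n * f ∈ p → f ∈ p := by
    intro n
    induction n with
    | zero => simp
    | succ n ih => exact fun f hf ↦ ih f (hreg _ (by rwa [pow_succ', mul_assoc] at hf))
  have key : ∀ f ∉ p, ∃ n, ∃ g ∉ p ⊔ Ideal.span {y}, f - y ^ n * g ∈ p := by
    intro f hf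
    have hex : ∃ n : ℕ, f ∉ p ⊔ Ideal.span {y ^ n} := by
      by_contra! hcon
      exact hf (hsep f hcon)
    -- The least exponent is positive because `y^0 = 1`; its predecessor `n` is the order of `f`.
    obtain ⟨n, hn⟩ : ∃ n, Nat.find hex = n + 1 := by
      refine ⟨Nat.find hex - 1, (Nat.succ_pred_eq_of_ne_zero fun h0 ↦ ?_).symm⟩
      have := Nat.find_spec hex
      rw [h0] at this
      simp at this
    have h1 := Nat.find_spec hex
    have h2 := Nat.find_min hex (m := n) (by omega)
    rw [hn] at h1
    rw [not_not] at h2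
    obtain ⟨u, hu, v, hv, rfl⟩ := Submodule.mem_sup.mp h2
    obtain ⟨g, rfl⟩ := Ideal.mem_span_singleton.mp hv
    refine ⟨n, g, fun hg ↦ h1 ?_, by simpa using hu⟩
    obtain ⟨u', hu', v', hv', rfl⟩ := Submodule.mem_sup.mp hg
    obtain ⟨g, rfl⟩ := Ideal.mem_span_singleton.mp hv'
    rw [show u + y ^ n * (u' + y * g) = (u + y ^ n * u') + y ^ (n + 1) * g by ring]
    exact Submodule.add_mem_sup (add_mem hu (p.mul_mem_left _ hu'))
      (Ideal.mem_span_singleton.mpr ⟨g, rfl⟩)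
  refine ⟨fun hp ↦ h.ne_top (by rw [hp, top_sup_eq]), fun {f g} hfg ↦ ?_⟩
  by_contra! hcon
  obtain ⟨n, f', hf', hf⟩ := key f hcon.1
  obtain ⟨m, g', hg', hg⟩ := key g hcon.2
  have h1 : y ^ (n + m) * (f' * g') ∈ p := by
    have : y ^ (n + m) * (f' * g') = f * g - f * (g - y ^ m * g') -
        (f - y ^ n * f') * (y ^ m * g') := by ring
    rw [this]
    exact sub_mem (sub_mem hfg (p.mul_mem_left _ hg)) (p.mul_mem_right _ hf)
  exact (h.mem_or_mem (Ideal.mem_sup_left (hreg' _ _ h1))).elim hf' hg'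

variable {A : Type u} [CommRing A] [IsLocalRing A] {Q : Ideal A} {x : A}

lemma maximalIdeal_quotient_eq_map [IsLocalRing (A ⧸ Ideal.span {x})] :
    maximalIdeal (A ⧸ Ideal.span {x}) =
      (maximalIdeal A).map (Ideal.Quotient.mk (Ideal.span {x})) := by
  have : IsLocalHom (Ideal.Quotient.mk (Ideal.span {x})) :=
    IsLocalHom.of_surjective _ Ideal.Quotient.mk_surjective
  apply le_antisymm
  · intro b hb
    obtain ⟨a, rfl⟩ := Ideal.Quotient.mk_surjective b
    exact Ideal.mem_map_of_mem _ ((map_mem_nonunits_iff (Ideal.Quotient.mk (Ideal.span {x})) a).mp hb)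
  · refine Ideal.map_le_iff_le_comap.mpr fun a ha ↦ ?_
    exact (map_mem_nonunits_iff (Ideal.Quotient.mk (Ideal.span {x})) a).mpr ha

/-- Under `A[Qt] → (A / (x))[Q̄t]`, the preimage of the extension of the maximal ideal is generated
by that of the maximal ideal of `A` and `xt`. -/
theorem comap_maxExtension [IsLocalRing (A ⧸ Ideal.span {x})] (hQ : Q ≤ maximalIdeal A)
    (hx : IsSuperficialRegular Q x) :
    (maxExtension (Q.map (Ideal.Quotient.mk (Ideal.span {x})))).comap
        (reesMap (Ideal.Quotient.mk (Ideal.span {x})) Q) =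
      maxExtension Q ⊔ Ideal.span {degreeOne Q ⟨x, hx.mem⟩} := by
  set π := Ideal.Quotient.mk (Ideal.span {x})
  have hmap : maxExtension (Q.map π) = (maxExtension Q).map (reesMap π Q) := by
    rw [maxExtension, maxExtension, maximalIdeal_quotient_eq_map, Ideal.map_map, Ideal.map_map]
    congr 1
    ext c : 1
    exact (reesMap_algebraMap c).symm
  have hπx : π x = 0 := Ideal.Quotient.eq_zero_iff_mem.mpr (Ideal.mem_span_singleton_self x)
  rw [hmap, Ideal.comap_map_of_surjective _ (reesMap_surjective Ideal.Quotient.mk_surjective)]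
  apply le_antisymm
  · refine sup_le le_sup_left fun f hf ↦ ?_
    have hf' : ∀ i, ∃ c, (algebraMap (Rees Q) A[X] f).coeff i = x * c := fun i ↦ by
      have h1 : (algebraMap (Rees Q) A[X] f).map π = 0 := by
        rw [← algebraMap_reesMap, (Ideal.mem_comap.mp hf : reesMap π Q f = 0), map_zero]
      have h2 := congrArg (coeff · i) h1
      rw [coeff_map, coeff_zero, Ideal.Quotient.eq_zero_iff_mem, Ideal.mem_span_singleton] at h2
      exact h2
    obtain ⟨g, hg⟩ := exists_polynomial_of_coeff
      (P := fun i c ↦ c ∈ Q ^ i ∧ (algebraMap (Rees Q) A[X] f).coeff (i + 1) = x * c) (fun i ↦ by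
        obtain ⟨c, hc⟩ := hf' (i + 1)
        refine ⟨c, ?_, hc⟩
        have := hx.mem_of_mul_mem ⊤ le_top i c
        rw [Ideal.top_mul, Ideal.top_mul, ← hc] at this
        exact this (coeff_algebraMap_rees f (i + 1)))
      (N := (algebraMap (Rees Q) A[X] f).natDegree) (fun i hi ↦
        ⟨zero_mem _, by rw [coeff_eq_zero_of_natDegree_lt (by omega), mul_zero]⟩)
    obtain ⟨c, hc⟩ := hf' 0
    -- All coefficients of an element of the kernel are divisible by `x`. In positive degree the
    -- cofactor drops into `Q^i`, giving a multiple of `xt`; the constant term is a multiple of `x ∈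
    -- 𝔪`.
    have key : f = algebraMap A (Rees Q) (x * c) +
        degreeOne Q ⟨x, hx.mem⟩ * reesMk g (fun i ↦ (hg i).1) := by
      apply algebraMap_rees_injective
      rw [map_add, algebraMap_algebraMap_rees, map_mul (algebraMap (Rees Q) A[X]),
        algebraMap_degreeOne, algebraMap_reesMk]
      ext (_ | i)
      · rw [coeff_add, coeff_C_zero, coeff_monomial_one_mul_zero, add_zero, hc]
      · rw [coeff_add, coeff_C_succ, coeff_monomial_one_mul_succ, zero_add, (hg i).2]
    rw [key]
    exact Submodule.add_mem_sup
      (Ideal.mem_map_of_mem _ (Ideal.mul_mem_right _ _ (hQ hx.mem)))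
      (Ideal.mul_mem_right _ _ (Ideal.mem_span_singleton_self _))
  · refine sup_le_sup_left ?_ _
    rw [Ideal.span_singleton_le_iff_mem, Ideal.mem_comap, reesMap_degreeOne_eq_zero hπx]
    exact zero_mem _

/-- The colon formula with `J = 𝔪` makes `xt` regular modulo `𝔪R(Q)`, and separatedness comes from
the grading: multiples of `(xt)^{i+1}` have no term of degree `i`. -/
theorem maxExtension_isPrime_of_quotient [IsLocalRing (A ⧸ Ideal.span {x})]
    (hQ : Q ≤ maximalIdeal A) (hx : IsSuperficialRegular Q x)
    (h : (maxExtension (Q.map (Ideal.Quotient.mk (Ideal.span {x})))).IsPrime) :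
    (maxExtension Q).IsPrime := by
  refine isPrime_of_isPrime_sup_span (y := degreeOne Q ⟨x, hx.mem⟩) ?_ ?_
    (comap_maxExtension hQ hx ▸ h.comap _)
  · intro f hf
    rw [mem_maxExtension_iff] at hf ⊢
    intro i
    refine hx.mem_of_mul_mem _ hQ i _ ?_
    have := hf (i + 1)
    rwa [map_mul, algebraMap_degreeOne, coeff_monomial_one_mul_succ] at this
  · intro f hf
    rw [mem_maxExtension_iff]
    intro i
    obtain ⟨u, hu, v, hv, rfl⟩ := Submodule.mem_sup.mp (hf (i + 1))
    obtain ⟨g, rfl⟩ := Ideal.mem_span_singleton.mp hv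
    have : (algebraMap (Rees Q) A[X] (degreeOne Q ⟨x, hx.mem⟩ ^ (i + 1) * g)).coeff i = 0 := by
      rw [map_mul, map_pow, algebraMap_degreeOne, ← C_mul_X_eq_monomial, mul_pow, mul_assoc,
        ← C_pow, coeff_C_mul, coeff_X_pow_mul', if_neg (by omega), mul_zero]
    rw [map_add, coeff_add, this, add_zero]
    exact mem_maxExtension_iff.mp hu i

end Prime

/-- Analytic independence: if `Q` is generated by a permutable regular sequence in the maximal
ideal, the extension of the maximal ideal to the Rees algebra of `Q` is prime. -/
theorem IsPermutableRegular.maxExtension_isPrime {ι : Type*} (U : Finset ι)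
    {A : Type u} [CommRing A] [IsLocalRing A]
    {a : ι → A} (ha : ∀ i ∈ U, a i ∈ maximalIdeal A)
    (h : IsPermutableRegular ⊥ (U : Set ι) a) :
    (maxExtension (Ideal.span (a '' (U : Set ι)))).IsPrime := by
  classical
  induction U using Finset.induction_on generalizing A with
  | empty =>
    set Q : Ideal A := Ideal.span (a '' ((∅ : Finset ι) : Set ι)) with hQ
    have hQ0 : Q = ⊥ := by simp [hQ]
    have : maxExtension Q =
        (maximalIdeal A).comap (constantCoeff.comp (algebraMap (Rees Q) A[X])) := by
      ext f
      rw [mem_maxExtension_iff, Ideal.mem_comap, RingHom.comp_apply, constantCoeff_apply]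
      refine ⟨fun h ↦ by simpa using h 0, fun h i ↦ ?_⟩
      cases i with
      | zero => simpa using h
      | succ i =>
        have := Ideal.pow_right_mono hQ0.le _ (coeff_algebraMap_rees f (i + 1))
        rw [show (algebraMap (Rees Q) A[X] f).coeff (i + 1) = 0 by simpa using this]
        exact zero_mem _
    rw [this]
    exact Ideal.IsPrime.comap _
  | insert j U hj ih =>
    have hjm : a j ∈ maximalIdeal A := ha j (by simp)
    have := isLocalRing_quotient_span_singleton hjm
    rw [Finset.coe_insert] at h ⊢
    have hQm : Ideal.span (a '' insert j (U : Set ι)) ≤ maximalIdeal A := by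
      rw [Ideal.span_le]
      rintro _ ⟨i, hi, rfl⟩
      exact ha i (by simpa using hi)
    refine maxExtension_isPrime_of_quotient hQm (h.isSuperficialRegular hj) ?_
    have hmap : (Ideal.span (a '' insert j (U : Set ι))).map
        (Ideal.Quotient.mk (Ideal.span {a j})) =
        Ideal.span ((fun i ↦ Ideal.Quotient.mk (Ideal.span {a j}) (a i)) '' (U : Set ι)) := by
      rw [Ideal.map_span, Set.image_image, Set.image_insert_eq, Ideal.span_insert,
        Ideal.Quotient.eq_zero_iff_mem.mpr (Ideal.mem_span_singleton_self _),
        Ideal.span_singleton_zero, bot_sup_eq]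
    rw [hmap]
    -- The remaining generators stay permutable regular over `A/(a j)`, so the induction has to vary
    -- the ring.
    refine ih (fun i hi ↦ ?_) ?_
    · rw [maximalIdeal_quotient_eq_map]
      exact Ideal.mem_map_of_mem _ (ha i (by simp [hi]))
    · have := h.sup_span (by simpa using hj)
      rw [bot_sup_eq] at this
      exact this.quotient

/-! ### Generation of the Sally module in degree one. -/

section Sally

variable {A : Type u} [CommRing A] {Q J : Ideal A}

lemma sallyMk_eq_zero_iff {f : idealMul Q J (reesAlgebra J)} :
    (Submodule.Quotient.mk f : SallyModule Q J) = 0 ↔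
      ∀ i, (f : A[X]).coeff i ∈ J * Q ^ i := by
  rw [Submodule.Quotient.mk_eq_zero, ← mem_idealMul_iff le_rfl]
  rfl

lemma coeff_mem_pow_of_mem_idealMul (hQJ : Q ≤ J) {f : A[X]}
    (hf : f ∈ idealMul Q J (reesAlgebra J)) (i : ℕ) : f.coeff i ∈ J ^ (i + 1) := by
  rw [pow_succ']
  exact (mem_idealMul_iff hQJ).mp hf i

lemma mem_idealMul_of_coeff_mem_pow (hQJ : Q ≤ J) {f : A[X]}
    (hf : ∀ i, f.coeff i ∈ J ^ (i + 1)) : f ∈ idealMul Q J (reesAlgebra J) :=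
  (mem_idealMul_iff hQJ).mpr fun i ↦ by rw [← pow_succ']; exact hf i

lemma monomial_mem_idealMul (hQJ : Q ≤ J) {i : ℕ} {c : A} (hc : c ∈ J ^ (i + 1)) :
    monomial i c ∈ idealMul Q J (reesAlgebra J) := by
  refine mem_idealMul_of_coeff_mem_pow hQJ fun k ↦ ?_
  rw [coeff_monomial]
  split_ifs with h
  · exact h ▸ hc
  · exact zero_mem _

lemma reesMk_monomial_smul {k i : ℕ} {b c : A} (hb : b ∈ Q ^ k) :
    reesMk (monomial k b) (coeff_monomial_mem hb) • (monomial i c : A[X]) =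
      monomial (k + i) (b * c) := by
  rw [Algebra.smul_def, algebraMap_reesMk, monomial_mul_monomial]

lemma degreeOne_smul (x : Q) (f : A[X]) : degreeOne Q x • f = monomial 1 (x : A) * f := by
  rw [Algebra.smul_def, algebraMap_degreeOne]

lemma algebraMap_smul_polynomial (c : A) (f : A[X]) :
    algebraMap A (Rees Q) c • f = C c * f := by
  rw [Algebra.smul_def, algebraMap_algebraMap_rees]

/-- The polynomials whose coefficients lie in the members of a family of ideals that is stable
under multiplication by powers of `Q`. -/
def coeffSubmodule (K : ℕ → Ideal A) (hK : ∀ j k, Q ^ j * K k ≤ K (j + k)) :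
    Submodule (Rees Q) A[X] where
  carrier := {f | ∀ i, f.coeff i ∈ K i}
  zero_mem' := fun i ↦ by rw [coeff_zero]; exact zero_mem _
  add_mem' := fun hf hg i ↦ by rw [coeff_add]; exact add_mem (hf i) (hg i)
  smul_mem' := fun r f hf i ↦ by
    rw [Algebra.smul_def, coeff_mul]
    refine sum_mem fun jk hjk ↦ ?_
    rw [← Finset.HasAntidiagonal.mem_antidiagonal.mp hjk]
    exact hK _ _ (Ideal.mul_mem_mul (coeff_algebraMap_rees r _) (hf _))

lemma pow_add_le_of_le {s : ℕ} (h : J ^ (s + 1) ≤ Q * J ^ s) (k : ℕ) :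
    J ^ (s + k) ≤ Q ^ k * J ^ s := by
  induction k with
  | zero => simp
  | succ k ih =>
    calc J ^ (s + (k + 1)) = J * J ^ (s + k) := by ring
      _ ≤ J * (Q ^ k * J ^ s) := Ideal.mul_mono_right ih
      _ = Q ^ k * J ^ (s + 1) := by ring
      _ ≤ Q ^ k * (Q * J ^ s) := Ideal.mul_mono_right h
      _ = Q ^ (k + 1) * J ^ s := by ring

lemma mem_of_monomial_mul_mem {W : Submodule (Rees Q) A[X]} {K : Ideal A} {i k : ℕ}
    (hW : ∀ c ∈ K, monomial i c ∈ W) {c : A} (hc : c ∈ Q ^ k * K) : monomial (k + i) c ∈ W := by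
  induction hc using Submodule.mul_induction_on' with
  | mem_mul_mem b hb c hc =>
    rw [← reesMk_monomial_smul hb]
    exact W.smul_mem _ (hW c hc)
  | add b _ c _ hb hc => rw [map_add]; exact add_mem hb hc

/-- Degree two of the generation condition reads `J^3 ⊆ QJ^2 + JQ^2`, and `JQ^2 ⊆ QJ^2`. Conversely
`J^3 ⊆ QJ^2` iterates to `J^{k+2} ⊆ Q^k J^2`, which covers every degree. -/
theorem sallyGeneratedInDegreeOne_iff (hQJ : Q ≤ J) :
    SallyGeneratedInDegreeOne Q J ↔ J ^ 3 ≤ Q * J ^ 2 := by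
  constructor
  · intro h c hc
    -- A graded submodule that contains `J^2 t` and is only `QJ^2` in degree two.
    let K : ℕ → Ideal A := fun i ↦ if i = 0 then J else Q ^ (i - 1) * J ^ 2
    have hK : ∀ j k, Q ^ j * K k ≤ K (j + k) := by
      rintro j (_ | k)
      · rcases j with _ | j
        · simp [K]
        · simp only [K, if_true, add_zero, Nat.succ_ne_zero, if_false, Nat.add_sub_cancel]
          calc Q ^ (j + 1) * J = Q ^ j * (Q * J) := by ring
            _ ≤ Q ^ j * (J * J) := Ideal.mul_mono_right (Ideal.mul_mono_left hQJ)
            _ = Q ^ j * J ^ 2 := by ring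
      · simp only [K, Nat.succ_ne_zero, if_false, Nat.add_sub_cancel, ← add_assoc]
        rw [← mul_assoc, pow_add]
    have hle : Submodule.span (Rees Q) (sallyComponent Q J 1) ≤
        ((coeffSubmodule K hK).submoduleOf (idealMul Q J (reesAlgebra J))).map
          (Submodule.mkQ _) := by
      refine Submodule.span_le.mpr ?_
      rintro _ ⟨b, hb, rfl⟩
      refine ⟨⟨monomial 1 b, hb⟩, fun i ↦ ?_, rfl⟩
      change (monomial 1 b).coeff i ∈ K i
      rw [coeff_monomial]
      split_ifs with hi
      · subst hi
        have := coeff_mem_pow_of_mem_idealMul hQJ hb 1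
        rw [coeff_monomial_same] at this
        simpa [K] using this
      · exact zero_mem _
    rw [SallyGeneratedInDegreeOne] at h
    rw [h] at hle
    obtain ⟨w, hw, hwc⟩ := hle (x := Submodule.Quotient.mk
      ⟨monomial 2 c, monomial_mem_idealMul hQJ hc⟩) trivial
    have h1 : (w : A[X]).coeff 2 ∈ Q * J ^ 2 := by simpa [K] using hw 2
    rw [Submodule.mkQ_apply, ← sub_eq_zero, ← Submodule.Quotient.mk_sub,
      sallyMk_eq_zero_iff] at hwc
    have h2 := hwc 2
    rw [AddSubgroupClass.coe_sub, coeff_sub, coeff_monomial_same] at h2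
    have h3 : J * Q ^ 2 ≤ Q * J ^ 2 :=
      calc J * Q ^ 2 = (Q * J) * Q := by ring
        _ ≤ (Q * J) * J := Ideal.mul_mono_right hQJ
        _ = Q * J ^ 2 := by ring
    have := sub_mem h1 (h3 h2)
    rwa [sub_sub_cancel] at this
  · intro h
    rw [SallyGeneratedInDegreeOne, eq_top_iff]
    rintro s -
    obtain ⟨⟨f, hf⟩, rfl⟩ := Submodule.Quotient.mk_surjective _ s
    set W := ((Submodule.span (Rees Q) (sallyComponent Q J 1)).comap (Submodule.mkQ _)).map
      (idealMul Q J (reesAlgebra J)).subtype with hW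
    have hmem : ∀ {g : A[X]} (hg : g ∈ idealMul Q J (reesAlgebra J)), g ∈ W →
        (Submodule.Quotient.mk ⟨g, hg⟩ : SallyModule Q J) ∈
          Submodule.span (Rees Q) (sallyComponent Q J 1) := by
      rintro g hg ⟨g', hg', rfl⟩
      exact hg'
    refine hmem hf (mem_of_monomial_mem fun i ↦ ?_)
    have hi := coeff_mem_pow_of_mem_idealMul hQJ hf i
    -- The component of degree zero is `J/J = 0`.
    rcases i with _ | k
    · refine ⟨⟨_, monomial_mem_idealMul hQJ hi⟩, ?_, rfl⟩
      change (Submodule.Quotient.mk _ : SallyModule Q J) ∈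
        Submodule.span (Rees Q) (sallyComponent Q J 1)
      rw [(sallyMk_eq_zero_iff).mpr fun i ↦ ?_]
      · exact zero_mem _
      · simp only [coeff_monomial]
        split_ifs with h0
        · subst h0; simpa using hi
        · exact zero_mem _
    · refine mem_of_monomial_mul_mem (i := 1) (K := J ^ 2) (fun c hc ↦ ?_)
        (pow_add_le_of_le h k (by rwa [show k + 1 + 1 = 2 + k by ring] at hi))
      exact ⟨⟨monomial 1 c, monomial_mem_idealMul hQJ hc⟩, Submodule.subset_span ⟨c, _, rfl⟩, rfl⟩

/-- Climb one power at a time: for `c ∈ J^j` with `j < i`, the class of `ct^j` in the associated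
graded ring is killed by `xt`, since `xc ∈ J^{j+2}`; hence `c ∈ J^{j+1}`. -/
theorem IsSuperRegular.mem_pow_of_mul_mem {x : A} (hx : IsSuperRegular J x) {i : ℕ} {c : A}
    (hc : x * c ∈ J ^ (i + 1)) : c ∈ J ^ i := by
  obtain ⟨hxJ, hx⟩ := hx
  have hreg : IsSMulRegular (AssociatedGraded J) (degreeOne J ⟨x, hxJ⟩) := by
    have := hx.toIsWeaklyRegular
    rw [List.map_cons, List.map_nil] at this
    exact ((RingTheory.Sequence.isWeaklyRegular_cons_iff _ _ _).mp this).1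
  have step : ∀ j ≤ i, c ∈ J ^ j := by
    intro j
    induction j with
    | zero => simp
    | succ j ih =>
      intro hj
      have hcj := ih (by omega)
      have h0 : (Ideal.Quotient.mk _ (reesMk (monomial j c) (coeff_monomial_mem hcj)) :
          AssociatedGraded J) = 0 := by
        refine hreg (?_ : _ = _)
        beta_reduce
        rw [smul_zero]
        change Ideal.Quotient.mk _ (degreeOne J ⟨x, hxJ⟩ *
          reesMk (monomial j c) (coeff_monomial_mem hcj)) = 0
        rw [Ideal.Quotient.eq_zero_iff_mem, mem_map_algebraMap_rees_iff]
        intro k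
        rw [map_mul, algebraMap_degreeOne, algebraMap_reesMk, monomial_mul_monomial,
          coeff_monomial]
        split_ifs with hk
        · rw [← pow_succ']
          exact Ideal.pow_le_pow_right (by omega) hc
        · exact zero_mem _
      rw [Ideal.Quotient.eq_zero_iff_mem, mem_map_algebraMap_rees_iff] at h0
      have := h0 j
      rwa [algebraMap_reesMk, coeff_monomial_same, ← pow_succ'] at this
  exact step i le_rfl

lemma mem_map_quotient_span_singleton_iff {x b : A} {K : Ideal A} :
    Ideal.Quotient.mk (Ideal.span {x}) b ∈ K.map (Ideal.Quotient.mk (Ideal.span {x})) ↔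
      ∃ c, b - x * c ∈ K := by
  rw [← Ideal.mem_comap, Ideal.comap_map_of_surjective _ Ideal.Quotient.mk_surjective,
    ← RingHom.ker_eq_comap_bot, Ideal.mk_ker]
  constructor
  · intro h
    obtain ⟨u, hu, v, hv, rfl⟩ := Submodule.mem_sup.mp h
    obtain ⟨c, rfl⟩ := Ideal.mem_span_singleton.mp hv
    exact ⟨c, by simpa using hu⟩
  · rintro ⟨c, hc⟩
    exact Submodule.mem_sup.mpr ⟨_, hc, x * c, Ideal.mem_span_singleton.mpr ⟨c, rfl⟩, by ring⟩

/-- To lift, write `c ∈ J^3` as an element of `QJ^2` plus `xb`. Then `xb ∈ J^3`, so `b ∈ J^2` by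
super-regularity and `xb ∈ QJ^2`. -/
theorem sallyGeneratedInDegreeOne_map_quotient_iff {x : A} (hQJ : Q ≤ J) (hxQ : x ∈ Q)
    (hx : IsSuperRegular J x) :
    SallyGeneratedInDegreeOne (Q.map (Ideal.Quotient.mk (Ideal.span {x})))
        (J.map (Ideal.Quotient.mk (Ideal.span {x}))) ↔ SallyGeneratedInDegreeOne Q J := by
  rw [sallyGeneratedInDegreeOne_iff hQJ, sallyGeneratedInDegreeOne_iff (Ideal.map_mono hQJ),
    ← Ideal.map_pow, ← Ideal.map_pow, ← Ideal.map_mul]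
  refine ⟨fun h c hc ↦ ?_, fun h ↦ Ideal.map_mono h⟩
  obtain ⟨b, hb⟩ := mem_map_quotient_span_singleton_iff.mp (h (Ideal.mem_map_of_mem _ hc))
  have hle : Q * J ^ 2 ≤ J ^ 3 := by
    rw [pow_succ' J 2]
    exact Ideal.mul_mono_left hQJ
  have hxb : x * b ∈ J ^ (2 + 1) := by
    have := sub_mem hc (hle hb)
    rwa [sub_sub_cancel] at this
  have := add_mem hb (Ideal.mul_mem_mul hxQ (hx.mem_pow_of_mul_mem hxb))
  rwa [sub_add_cancel] at this

end Sally

/-! ### Finiteness and support of the Sally module. -/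

section SallyFinite

variable {A : Type u} [CommRing A] {Q J : Ideal A}

/-- The reduction equation puts all generators of `JR(J)` in degrees at most `r`, and `R(Q)` is
Noetherian. -/
theorem finite_sallyModule [IsNoetherianRing A] (h : IsReduction Q J) :
    Module.Finite (Rees Q) (SallyModule Q J) := by
  obtain ⟨hQJ, r, hr⟩ := h
  choose G hG using fun i : ℕ ↦ (isNoetherianRing_iff_ideal_fg A).mp ‹_› (J ^ (i + 1))
  let W : Submodule (Rees Q) A[X] :=
    ⨆ i ∈ Finset.range (r + 1), Submodule.span (Rees Q) (monomial i '' (G i : Set A))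
  have hWfg : W.FG :=
    Submodule.fg_biSup _ _ fun i _ ↦ Submodule.fg_span ((G i).finite_toSet.image _)
  have hW : ∀ i ≤ r, ∀ c ∈ J ^ (i + 1), monomial i c ∈ W := by
    intro i hi c hc
    rw [← hG i] at hc
    refine (le_biSup (fun i ↦ Submodule.span (Rees Q) (monomial i '' (G i : Set A)))
      (Finset.mem_range.mpr (Nat.lt_succ_of_le hi)) : _ ≤ W) ?_
    induction hc using Submodule.span_induction with
    | mem c hc => exact Submodule.subset_span ⟨c, hc, rfl⟩
    | zero => rw [map_zero]; exact zero_mem _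
    | add b c _ _ hb hc => rw [map_add]; exact add_mem hb hc
    | smul b c _ hc =>
      have := Submodule.smul_mem _ (algebraMap A (Rees Q) b) hc
      rwa [algebraMap_smul_polynomial, C_mul_monomial] at this
  have hle : idealMul Q J (reesAlgebra J) ≤ W := by
    refine fun f hf ↦ mem_of_monomial_mem fun i ↦ ?_
    have hfi := coeff_mem_pow_of_mem_idealMul hQJ hf i
    rcases le_or_gt i r with hi | hi
    · exact hW i hi _ hfi
    · obtain ⟨k, rfl⟩ := Nat.exists_eq_add_of_le hi.le
      rw [add_comm r k]
      refine mem_of_monomial_mul_mem (K := J ^ (r + 1)) (hW r le_rfl) (pow_add_le_of_le ?_ k ?_)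
      · rw [pow_succ', hr, ← mul_assoc, mul_comm J Q, mul_assoc, ← pow_succ', hr]
      · rwa [add_comm k r, show r + 1 + k = r + k + 1 by ring]
  have : IsNoetherian (Rees Q) W := isNoetherian_of_fg_of_noetherian W hWfg
  have : IsNoetherian (Rees Q) (idealMul Q J (reesAlgebra J)) := isNoetherian_of_le hle
  infer_instance

/-- A single power works in all degrees: `Q^{r+1}J^{i+1} ⊆ JQ^i`, trivially for `i ≤ r` and by the
reduction equation beyond. This supplies the annihilation hypothesis of the associativity formula.
-/
theorem exists_maxExtension_pow_smul_eq_zero [IsLocalRing A] [IsNoetherianRing A]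
    (hQ : maximalIdeal A ≤ Q.radical) (h : IsReduction Q J) :
    ∃ k, ∀ b ∈ maxExtension Q ^ k, ∀ s : SallyModule Q J, b • s = 0 := by
  obtain ⟨hQJ, r, hr⟩ := h
  obtain ⟨k, hk⟩ := Ideal.exists_pow_le_of_le_radical_of_fg (I := maximalIdeal A) (J := Q ^ (r + 1))
    (hQ.trans (Ideal.radical_pow Q r.succ_ne_zero).ge) (IsNoetherian.noetherian _)
  have key : ∀ i, Q ^ (r + 1) * J ^ (i + 1) ≤ J * Q ^ i := by
    intro i
    rcases le_or_gt i r with hi | hi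
    · calc Q ^ (r + 1) * J ^ (i + 1) ≤ Q ^ i * J ^ 1 :=
          Ideal.mul_mono (Ideal.pow_le_pow_right (by omega)) (Ideal.pow_le_pow_right (by omega))
        _ = J * Q ^ i := by ring
    · obtain ⟨j, rfl⟩ := Nat.exists_eq_add_of_le hi.le
      calc Q ^ (r + 1) * J ^ (r + j + 1) = Q ^ (r + 1) * J ^ (r + (j + 1)) := by ring
        _ ≤ Q ^ (r + 1) * (Q ^ (j + 1) * J ^ r) :=
          Ideal.mul_mono_right (pow_add_le_of_le hr.le _)
        _ ≤ Q ^ (r + 1) * (Q ^ (j + 1) * ⊤) :=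
          Ideal.mul_mono_right (Ideal.mul_mono_right le_top)
        _ = Q * Q ^ (r + j + 1) := by rw [Ideal.mul_top]; ring
        _ ≤ J * Q ^ (r + j) := Ideal.mul_mono hQJ (Ideal.pow_le_pow_right (by omega))
  have hle : maxExtension Q ^ k ≤ Module.annihilator (Rees Q) (SallyModule Q J) := by
    rw [maxExtension, ← Ideal.map_pow, Ideal.map_le_iff_le_comap]
    intro c hc
    rw [Ideal.mem_comap, Module.mem_annihilator]
    intro s
    obtain ⟨⟨f, hf⟩, rfl⟩ := Submodule.Quotient.mk_surjective _ s
    rw [← Submodule.Quotient.mk_smul, sallyMk_eq_zero_iff]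
    intro i
    rw [Submodule.coe_smul, algebraMap_smul_polynomial, coeff_C_mul]
    exact key i (Ideal.mul_mem_mul (hk hc) (coeff_mem_pow_of_mem_idealMul hQJ hf i))
  exact ⟨k, fun b hb ↦ Module.mem_annihilator.mp (hle hb)⟩

end SallyFinite

/-! ### The Sally module modulo `xt`. -/

section SallyQuotient

variable {A : Type u} [CommRing A] {Q J : Ideal A} {x : A}

theorem IsSuperficialRegular.subsingleton_smulKer_sallyModule (hx : IsSuperficialRegular Q x)
    (hQJ : Q ≤ J) : Subsingleton (smulKer (degreeOne Q ⟨x, hx.mem⟩) (SallyModule Q J)) := by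
  refine subsingleton_of_forall_eq 0 fun ⟨s, hs⟩ ↦ Subtype.ext ?_
  change s = 0
  replace hs : degreeOne Q ⟨x, hx.mem⟩ • s = 0 := hs
  obtain ⟨⟨f, hf⟩, rfl⟩ := Submodule.Quotient.mk_surjective _ s
  rw [← Submodule.Quotient.mk_smul, sallyMk_eq_zero_iff] at hs
  rw [sallyMk_eq_zero_iff]
  intro i
  have := hs (i + 1)
  rw [Submodule.coe_smul, degreeOne_smul, coeff_monomial_one_mul_succ] at this
  exact hx.mem_of_mul_mem J hQJ i _ this

/-- Otherwise `x · 1 ∈ 𝔪Q`, and the colon formula for `J = 𝔪` yields `1 ∈ 𝔪`. -/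
theorem IsSuperficialRegular.degreeOne_notMem_maxExtension [IsLocalRing A]
    (hx : IsSuperficialRegular Q x) (hQ : Q ≤ maximalIdeal A) :
    degreeOne Q ⟨x, hx.mem⟩ ∉ maxExtension Q := by
  intro h
  have h1 := mem_maxExtension_iff.mp h 1
  rw [algebraMap_degreeOne, coeff_monomial_same] at h1
  have h2 := hx.mem_of_mul_mem _ hQ 0 1 (by simpa using h1)
  rw [pow_zero, mul_one, ← Ideal.eq_top_iff_one] at h2
  exact (maximalIdeal.isMaximal A).ne_top h2

variable {B : Type u} [CommRing B] (φ : A →+* B)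

/-- The map of Sally modules induced by a ring homomorphism, on the level of `J A[Jt]`. -/
noncomputable def idealMulMap (hQJ : Q ≤ J) :
    idealMul Q J (reesAlgebra J) →ₛₗ[reesMap φ Q]
      idealMul (Q.map φ) (J.map φ) (reesAlgebra (J.map φ)) where
  toFun f := ⟨(f : A[X]).map φ, mem_idealMul_of_coeff_mem_pow (Ideal.map_mono hQJ) fun i ↦ by
    rw [coeff_map, ← Ideal.map_pow]
    exact Ideal.mem_map_of_mem _ (coeff_mem_pow_of_mem_idealMul hQJ f.2 i)⟩
  map_add' f g := Subtype.ext (Polynomial.map_add φ)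
  map_smul' r f := Subtype.ext (by
    simp only [Submodule.coe_smul, Algebra.smul_def, Polynomial.map_mul, algebraMap_reesMap])

/-- The map of Sally modules induced by a ring homomorphism. -/
noncomputable def sallyMap (hQJ : Q ≤ J) :
    SallyModule Q J →ₛₗ[reesMap φ Q] SallyModule (Q.map φ) (J.map φ) :=
  Submodule.mapQ _ _ (idealMulMap φ hQJ) fun f hf ↦ by
    have hf' : (f : A[X]) ∈ idealMul Q J (reesAlgebra Q) := hf
    change ((f : A[X]).map φ) ∈ idealMul _ _ (reesAlgebra (Q.map φ))
    rw [mem_idealMul_iff le_rfl] at hf' ⊢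
    intro i
    rw [coeff_map, ← Ideal.map_pow, ← Ideal.map_mul]
    exact Ideal.mem_map_of_mem _ (hf' i)

lemma sallyMap_surjective (hQJ : Q ≤ J) (hφ : Function.Surjective φ) :
    Function.Surjective (sallyMap φ hQJ) := by
  intro s
  obtain ⟨⟨g, hg⟩, rfl⟩ := Submodule.Quotient.mk_surjective _ s
  obtain ⟨f, hf, hfJ⟩ := exists_polynomial_lift hφ (K := fun i ↦ J ^ (i + 1)) (g := g) fun i ↦ by
    rw [Ideal.map_pow]
    exact coeff_mem_pow_of_mem_idealMul (Ideal.map_mono hQJ) hg i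
  exact ⟨Submodule.Quotient.mk ⟨f, mem_idealMul_of_coeff_mem_pow hQJ hfJ⟩,
    congrArg Submodule.Quotient.mk (Subtype.ext hf)⟩

/-- The coefficient of degree `i + 1` is `xc` modulo `JQ^{i+1}`, so `xc ∈ J^{i+2}` and `c ∈
J^{i+1}`. These `c` are the coefficients of the preimage; degree zero imposes nothing. -/
lemma exists_smul_eq_of_sallyMap_eq_zero (hQJ : Q ≤ J) (hxQ : x ∈ Q) (hx : IsSuperRegular J x)
    {s : SallyModule Q J} (hs : sallyMap (Ideal.Quotient.mk (Ideal.span {x})) hQJ s = 0) :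
    ∃ t : SallyModule Q J, degreeOne Q ⟨x, hxQ⟩ • t = s := by
  obtain ⟨⟨f, hf⟩, rfl⟩ := Submodule.Quotient.mk_surjective _ s
  replace hs := sallyMk_eq_zero_iff.mp hs
  have hs' : ∀ i, ∃ c, f.coeff i - x * c ∈ J * Q ^ i := fun i ↦ by
    have := hs i
    change ((f.map _).coeff i) ∈ _ at this
    rwa [coeff_map, ← Ideal.map_pow, ← Ideal.map_mul,
      mem_map_quotient_span_singleton_iff] at this
  have hle : ∀ i, J * Q ^ i ≤ J ^ (i + 1) := fun i ↦ by
    rw [pow_succ']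
    exact Ideal.mul_mono_right (Ideal.pow_right_mono hQJ i)
  obtain ⟨g, hg⟩ := exists_polynomial_of_coeff
    (P := fun i c ↦ c ∈ J ^ (i + 1) ∧ f.coeff (i + 1) - x * c ∈ J * Q ^ (i + 1)) (fun i ↦ by
      obtain ⟨c, hc⟩ := hs' (i + 1)
      refine ⟨c, hx.mem_pow_of_mul_mem ?_, hc⟩
      have := sub_mem (coeff_mem_pow_of_mem_idealMul hQJ hf (i + 1)) (hle _ hc)
      rwa [sub_sub_cancel] at this)
    (N := f.natDegree) (fun i hi ↦ ⟨zero_mem _, by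
      rw [coeff_eq_zero_of_natDegree_lt (by omega), mul_zero, sub_zero]; exact zero_mem _⟩)
  refine ⟨Submodule.Quotient.mk ⟨g, mem_idealMul_of_coeff_mem_pow hQJ fun i ↦ (hg i).1⟩, ?_⟩
  rw [eq_comm, ← sub_eq_zero, ← Submodule.Quotient.mk_smul, ← Submodule.Quotient.mk_sub,
    sallyMk_eq_zero_iff]
  intro i
  rw [AddSubgroupClass.coe_sub, Submodule.coe_smul, degreeOne_smul, coeff_sub]
  cases i with
  | zero =>
    rw [coeff_monomial_one_mul_zero, sub_zero]
    simpa using coeff_mem_pow_of_mem_idealMul hQJ hf 0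
  | succ i =>
    rw [coeff_monomial_one_mul_succ]
    exact (hg i).2

/-- Reducing the Sally module modulo `xt` yields the Sally module over `A / (x)`. -/
noncomputable def sallyCokerMap (hQJ : Q ≤ J) (hxQ : x ∈ Q) :
    SMulCoker (degreeOne Q ⟨x, hxQ⟩) (SallyModule Q J)
      →ₛₗ[reesMap (Ideal.Quotient.mk (Ideal.span {x})) Q]
      SallyModule (Q.map (Ideal.Quotient.mk (Ideal.span {x})))
        (J.map (Ideal.Quotient.mk (Ideal.span {x}))) :=
  Submodule.liftQ _ (sallyMap _ hQJ) (by
    rintro _ ⟨s, rfl⟩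
    rw [LinearMap.mem_ker, LinearMap.lsmul_apply, map_smulₛₗ, reesMap_degreeOne_eq_zero, zero_smul]
    exact Ideal.Quotient.eq_zero_iff_mem.mpr (Ideal.mem_span_singleton_self x))

lemma sallyCokerMap_bijective (hQJ : Q ≤ J) (hxQ : x ∈ Q) (hx : IsSuperRegular J x) :
    Function.Bijective (sallyCokerMap hQJ hxQ) := by
  constructor
  · rw [injective_iff_map_eq_zero]
    intro s hs
    obtain ⟨s, rfl⟩ := Submodule.Quotient.mk_surjective _ s
    obtain ⟨t, ht⟩ := exists_smul_eq_of_sallyMap_eq_zero hQJ hxQ hx hs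
    exact (Submodule.Quotient.mk_eq_zero _).mpr ⟨t, ht⟩
  · intro s
    obtain ⟨t, rfl⟩ := sallyMap_surjective _ hQJ Ideal.Quotient.mk_surjective s
    exact ⟨Submodule.Quotient.mk t, rfl⟩

theorem sallyRankEq_map_quotient_iff [IsLocalRing A] [IsNoetherianRing A]
    [IsLocalRing (A ⧸ Ideal.span {x})] (hQ : Q.radical = maximalIdeal A) (hJ : IsReduction Q J)
    (hx : IsSuperficialRegular Q x) (hxs : IsSuperRegular J x)
    (hp : (maxExtension Q).IsPrime)
    (hp' : (maxExtension (Q.map (Ideal.Quotient.mk (Ideal.span {x})))).IsPrime) (n : ℕ) :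
    SallyRankEq (Q.map (Ideal.Quotient.mk (Ideal.span {x})))
        (J.map (Ideal.Quotient.mk (Ideal.span {x}))) n ↔ SallyRankEq Q J n := by
  have hQm : Q ≤ maximalIdeal A := hQ ▸ Ideal.le_radical
  have hcomap := comap_maxExtension hQm hx
  have hq : ((maxExtension (Q.map (Ideal.Quotient.mk (Ideal.span {x})))).comap
      (reesMap (Ideal.Quotient.mk (Ideal.span {x})) Q)).IsPrime := hp'.comap _
  have := finite_sallyModule hJ
  obtain ⟨k, hk⟩ := exists_maxExtension_pow_smul_eq_zero hQ.ge hJ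
  have h1 := localLength_smulCoker (hx.degreeOne_notMem_maxExtension hQm) hcomap hk
  have := hx.subsingleton_smulKer_sallyModule hJ.1
  rw [localLength_of_subsingleton _ (M := smulKer _ _), add_zero,
    localLength_comap (P' := maxExtension (Q.map (Ideal.Quotient.mk (Ideal.span {x})))) (reesMap_surjective Ideal.Quotient.mk_surjective) rfl
      (sallyCokerMap hJ.1 hx.mem) (sallyCokerMap_bijective hJ.1 hx.mem hxs)] at h1
  exact ⟨fun ⟨_, h⟩ ↦ ⟨hp, h1.symm.trans h⟩, fun ⟨_, h⟩ ↦ ⟨hp', h1.trans h⟩⟩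

end SallyQuotient

/-! ### Exchanging a parameter and passing to `A/(x)`. -/

section Parameters

variable {A : Type u} [CommRing A]

/-- A minimal generator can be exchanged for a member of a given generating family. -/
lemma exists_span_range_update_eq [IsLocalRing A] {ι : Type*} [Finite ι] [DecidableEq ι] {a : ι → A}
    {s : Set ι} {x : A} (hx : x ∈ Ideal.span (a '' s))
    (hx' : x ∉ maximalIdeal A * Ideal.span (a '' s)) :
    ∃ j ∈ s, Ideal.span (Set.range (Function.update a j x)) = Ideal.span (Set.range a) := by
  classical
  have := Fintype.ofFinite ι
  have hsum := hx
  rw [Set.image_eq_range, Ideal.mem_span_range_iff_exists_fun] at hsum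
  obtain ⟨c, hc⟩ := hsum
  -- If all coefficients were in `𝔪`, then `x` would lie in `𝔪` times the ideal; the generator with
  -- unit coefficient is the one exchanged.
  obtain ⟨j, hj⟩ : ∃ j, c j ∉ maximalIdeal A := by
    by_contra! h
    refine hx' (hc ▸ sum_mem fun i _ ↦ Ideal.mul_mem_mul (h i) (Ideal.subset_span ⟨i, i.2, rfl⟩))
  have hju : IsUnit (c j) := by simpa using hj
  refine ⟨j, j.2, le_antisymm ?_ ?_⟩
  · rw [Ideal.span_le]
    rintro _ ⟨i, rfl⟩
    by_cases hij : i = j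
    · subst hij
      rw [Function.update_self]
      exact Ideal.span_mono (Set.image_subset_range _ _) hx
    · rw [Function.update_of_ne hij]
      exact Ideal.subset_span ⟨i, rfl⟩
  · rw [Ideal.span_le]
    have hne : ∀ i, i ≠ (j : ι) → a i ∈ Ideal.span (Set.range (Function.update a j x)) :=
      fun i hij ↦ Ideal.subset_span ⟨i, Function.update_of_ne hij _ _⟩
    rintro _ ⟨i, rfl⟩
    by_cases hij : i = j
    · subst hij
      refine (Ideal.unit_mul_mem_iff_mem _ hju).mp ?_
      rw [← Finset.add_sum_erase _ _ (Finset.mem_univ j), ← eq_sub_iff_add_eq] at hc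
      rw [hc]
      refine sub_mem (Ideal.subset_span ⟨j, Function.update_self _ _ _⟩)
        (sum_mem fun i hi ↦ Ideal.mul_mem_left _ _ (hne i fun h ↦ ?_))
      exact Finset.ne_of_mem_erase hi (Subtype.ext h)
    · exact hne i hij

lemma IsReduction.map {B : Type u} [CommRing B] {Q J : Ideal A} (h : IsReduction Q J)
    (φ : A →+* B) : IsReduction (Q.map φ) (J.map φ) := by
  obtain ⟨hQJ, r, hr⟩ := h
  exact ⟨Ideal.map_mono hQJ, r, by rw [← Ideal.map_pow, ← Ideal.map_pow, ← Ideal.map_mul, hr]⟩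

lemma span_range_succAbove_quotient {d : ℕ} (a : Fin (d + 1) → A) (j : Fin (d + 1)) :
    Ideal.span (Set.range fun i ↦ Ideal.Quotient.mk (Ideal.span {a j}) (a (j.succAbove i))) =
      (Ideal.span (Set.range a)).map (Ideal.Quotient.mk (Ideal.span {a j})) := by
  rw [Ideal.map_span]
  apply le_antisymm
  · refine Ideal.span_mono ?_
    rintro _ ⟨i, rfl⟩
    exact ⟨_, ⟨_, rfl⟩, rfl⟩
  · rw [Ideal.span_le]
    rintro _ ⟨_, ⟨i, rfl⟩, rfl⟩
    rcases Fin.eq_self_or_eq_succAbove j i with rfl | ⟨k, rfl⟩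
    · rw [Ideal.Quotient.eq_zero_iff_mem.mpr (Ideal.mem_span_singleton_self _)]
      exact zero_mem _
    · exact Ideal.subset_span ⟨k, rfl⟩

variable [IsCohenMacaulayLocalRing A] {d : ℕ} {a : Fin d → A}

lemma IsSystemOfParameters.isSMulRegular (ha : IsSystemOfParameters a) (j : Fin d) :
    IsSMulRegular A (a j) := by
  refine isSMulRegular_iff_right_eq_zero_of_smul.mpr fun c hc ↦ ?_
  have := ha.isPermutableRegular ∅ (Set.empty_subset _) j trivial (Set.notMem_empty _) c
  simpa using this (by simpa using hc)

lemma IsSystemOfParameters.isSuperficialRegular (ha : IsSystemOfParameters a) (j : Fin d) :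
    IsSuperficialRegular (Ideal.span (Set.range a)) (a j) := by
  have huniv : insert j ((Finset.univ.erase j : Finset (Fin d)) : Set (Fin d)) = Set.univ := by
    ext i; by_cases h : i = j <;> simp [h]
  have := IsPermutableRegular.isSuperficialRegular (Finset.notMem_erase j Finset.univ)
    (huniv ▸ ha.isPermutableRegular)
  rwa [huniv, Set.image_univ] at this

lemma IsSystemOfParameters.maxExtension_isPrime (ha : IsSystemOfParameters a) :
    (maxExtension (Ideal.span (Set.range a))).IsPrime := by
  have := IsPermutableRegular.maxExtension_isPrime Finset.univ (fun i _ ↦ ha.mem_maximalIdeal i)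
    (by rw [Finset.coe_univ]; exact ha.isPermutableRegular)
  rwa [Finset.coe_univ, Set.image_univ] at this

end Parameters

lemma IsSystemOfParameters.quotient {A : Type u} [CommRing A] [IsCohenMacaulayLocalRing A] {d : ℕ}
    {a : Fin (d + 1) → A} (ha : IsSystemOfParameters a) (j : Fin (d + 1))
    [IsLocalRing (A ⧸ Ideal.span {a j})] :
    IsSystemOfParameters fun i ↦ Ideal.Quotient.mk (Ideal.span {a j}) (a (j.succAbove i)) where
  dim_eq := (ringKrullDim_quotient_span_singleton (ha.mem_maximalIdeal j)
    (ha.isSMulRegular j)).mpr ha.dim_eq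
  radical_eq := by
    rw [span_range_succAbove_quotient, ← Ideal.map_radical_of_surjective
      Ideal.Quotient.mk_surjective, ha.radical_eq, maximalIdeal_quotient_eq_map]
    rw [Ideal.mk_ker, Ideal.span_singleton_le_iff_mem]
    exact Ideal.subset_span ⟨j, rfl⟩

lemma IsSharpSystem.update {A : Type u} [CommRing A] [IsLocalRing A] {I : Ideal A} {d : ℕ}
    [NeZero d] {a : Fin d → A} (ha : IsSharpSystem I a) {j : Fin d} (hj : j ≠ 0) {x : A}
    (h : Ideal.span (Set.range (Function.update a j x)) = Ideal.span (Set.range a)) :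
    IsSharpSystem I (Function.update a j x) where
  isSystemOfParameters := ⟨ha.isSystemOfParameters.dim_eq,
    h ▸ ha.isSystemOfParameters.radical_eq⟩
  first_mem := by rw [Function.update_of_ne hj.symm]; exact ha.first_mem
  isReduction := h ▸ ha.isReduction

lemma IsSharpSystem.quotient {A : Type u} [CommRing A] [IsCohenMacaulayLocalRing A] {I : Ideal A}
    {d : ℕ} [NeZero d] {a : Fin (d + 1) → A} (ha : IsSharpSystem I a) {j : Fin (d + 1)}
    (hj : j ≠ 0) [IsLocalRing (A ⧸ Ideal.span {a j})] :
    IsSharpSystem (I.map (Ideal.Quotient.mk (Ideal.span {a j})))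
      fun i ↦ Ideal.Quotient.mk (Ideal.span {a j}) (a (j.succAbove i)) where
  isSystemOfParameters := ha.isSystemOfParameters.quotient j
  first_mem := by
    -- Dropping an index `j ≠ 0` leaves `a 0` in first position.
    rw [Fin.succAbove_ne_zero_zero hj]
    exact Ideal.mem_map_of_mem _ ha.first_mem
  isReduction := by
    rw [span_range_succAbove_quotient, ← Ideal.map_sup]
    exact ha.isReduction.map _

/-- The case in which `x` is one of the given parameters. -/
theorem IsSharpSystem.isGoto_quotient_iff {A : Type u} [CommRing A] [IsCohenMacaulayLocalRing A]
    {I : Ideal A} (hI : IsCanonicalIdeal I) {d : ℕ} [NeZero d] (n : ℕ) {a : Fin (d + 1) → A}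
    (ha : IsSharpSystem I a) {j : Fin (d + 1)} (hj : j ≠ 0) {Q : Ideal A}
    (hQ : Ideal.span (Set.range a) = Q) (hsr : IsSuperRegular (I ⊔ Q) (a j)) :
    ∃ _ : IsCohenMacaulayLocalRing (A ⧸ Ideal.span {a j}),
      IsCanonicalIdeal (I.map (Ideal.Quotient.mk (Ideal.span {a j}))) ∧
      SatisfiesSharp (I.map (Ideal.Quotient.mk (Ideal.span {a j})))
        (Q.map (Ideal.Quotient.mk (Ideal.span {a j}))) ∧
      (IsGotoWithRespectTo I Q n ↔
        IsGotoWithRespectTo (I.map (Ideal.Quotient.mk (Ideal.span {a j})))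
          (Q.map (Ideal.Quotient.mk (Ideal.span {a j}))) n) := by
  subst hQ
  have hsop := ha.isSystemOfParameters
  have hm := hsop.mem_maximalIdeal j
  have hreg := hsop.isSMulRegular j
  have hCM := IsCohenMacaulayLocalRing.quotient hm hreg hsop.dim_eq
  have hcan : IsCanonicalIdeal (I.map (Ideal.Quotient.mk (Ideal.span {a j}))) :=
    hI.map_quotient hm hreg hsop.dim_eq fun c ↦
      hsop.mem_of_mul_mem_ideal hI.isCanonicalModule.exists_isRegular hj.symm ha.first_mem
  have hsharp : SatisfiesSharp (I.map (Ideal.Quotient.mk (Ideal.span {a j})))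
      ((Ideal.span (Set.range a)).map (Ideal.Quotient.mk (Ideal.span {a j}))) :=
    ⟨d, inferInstance, _, ha.quotient hj, span_range_succAbove_quotient a j⟩
  have hp' : (maxExtension
      ((Ideal.span (Set.range a)).map (Ideal.Quotient.mk (Ideal.span {a j})))).IsPrime := by
    rw [← span_range_succAbove_quotient]
    exact (hsop.quotient j).maxExtension_isPrime
  have hgen := sallyGeneratedInDegreeOne_map_quotient_iff ha.isReduction.1
    (Ideal.subset_span ⟨j, rfl⟩) hsr
  have hrank := sallyRankEq_map_quotient_iff hsop.radical_eq ha.isReduction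
    (hsop.isSuperficialRegular j) hsr hsop.maxExtension_isPrime hp' n
  rw [Ideal.map_sup] at hgen hrank
  exact ⟨hCM, hcan, hsharp,
    fun h ↦ ⟨hcan, hsharp, hgen.mpr h.generated, hrank.mpr h.rank_eq⟩,
    fun h ↦ ⟨hI, ⟨d + 1, inferInstance, a, ha, rfl⟩, hgen.mp h.generated, hrank.mp h.rank_eq⟩⟩

end GotoRing

theorem theorem3p5 {A : Type u} [CommRing A] [GotoRing.IsCohenMacaulayLocalRing A]
    (I : Ideal A) (hI : GotoRing.IsCanonicalIdeal I)
    (d : ℕ) [NeZero d] (hd : 2 ≤ d) (n : ℕ)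
    (a : Fin d → A) (ha : GotoRing.IsSharpSystem I a)
    (Q q : Ideal A) (hQ : Q = Ideal.span (Set.range a)) (hq : q = Ideal.span (a '' {i | i ≠ 0}))
    (x : A) (hx : x ∈ q) (hx' : x ∉ IsLocalRing.maximalIdeal A * q)
    (hsr : GotoRing.IsSuperRegular (I ⊔ Q) x) :
    ∃ _ : GotoRing.IsCohenMacaulayLocalRing (A ⧸ Ideal.span {x}),
      GotoRing.IsCanonicalIdeal (I.map (Ideal.Quotient.mk (Ideal.span {x}))) ∧
      GotoRing.SatisfiesSharp (I.map (Ideal.Quotient.mk (Ideal.span {x})))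
        (Q.map (Ideal.Quotient.mk (Ideal.span {x}))) ∧
      (GotoRing.IsGotoWithRespectTo I Q n ↔
        GotoRing.IsGotoWithRespectTo (I.map (Ideal.Quotient.mk (Ideal.span {x})))
          (Q.map (Ideal.Quotient.mk (Ideal.span {x}))) n) := by
  obtain ⟨d, rfl⟩ : ∃ d', d = d' + 1 := ⟨d - 1, by omega⟩
  -- From here `d` is the dimension of `A/(x)`; it is positive because the original dimension is at
  -- least two.
  have : NeZero d := ⟨by omega⟩
  subst hq
  obtain ⟨j, hj, hspan⟩ := GotoRing.exists_span_range_update_eq hx hx'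
  have ha' := ha.update hj hspan
  have hbj : Function.update a j x j = x := Function.update_self j x a
  -- Afterwards `x` is literally the parameter `b j`.
  generalize Function.update a j x = b at ha' hspan hbj
  subst hbj
  exact ha'.isGoto_quotient_iff hI n hj (hspan.trans hQ.symm) hsr
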